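/- Let $E$ be a finite-dimensional real normed space (for instance $\mathbb R^n$ with any norm, so that linear operators on $E$ are $n\times n$ matrices), and let $|\cdot|$ denote both the norm of $E$ and the corresponding operator norm. Let $J$ be an interval of the form $[a,\infty)$, $(-\infty,b]$ or $(-\infty,\infty)$. A function on $J$ is called piecewise continuous if it has finitely many discontinuities in each bounded part of $J$ and has one-sided limits at every point of $J$. For a piecewise continuous function $A$ on $J$ with values in the linear operators on $E$, the transition operator $\Phi(t,s)$, $t,s\in J$, of $\dot x=A(t)x$ is the operator-valued function that for each $s$ is continuous in $t\in J$, satisfies $\Phi(s,s)=I$, and satisfies $\partial_t\Phi(t,s)=A(t)\Phi(t,s)$ at all $t\in J$ at which $A$ is continuous (with a one-sided derivative at an endpoint of $J$). The equation $\dot x=A(t)x$ has an exponential dichotomy on $J$ with projection $P(t)$ and constants $K\ge 1$, $\alpha>0$ if $P(t)$, $t\in J$, are projections of constant rank with $\Phi(t,s)P(s)=P(t)\Phi(t,s)$ for all $t,s\in J$ and $$|\Phi(t,s)P(s)|\le Ke^{-\alpha(t-s)},\qquad |\Phi(s,t)(I-P(t))|\le Ke^{-\alpha(t-s)}\qquad\text{for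 all } s\le t \text{ in } J.$$ **Theorem.** Let $A$ and $B$ be piecewise continuous functions on $J$ with values in the linear operators on $E$. Suppose that $\dot x=A(t)x$ has an exponential dichotomy on $J$ with projection $P(t)$ and constants $K$, $\alpha$, and that $|B(t)|\le\delta$ for all $t\in J$, where $2K\alpha^{-1}\delta<1$. Put $$\beta=\alpha\sqrt{1-2K\alpha^{-1}\delta},\qquad L=\frac{2K\bigl(1+K\delta(1-2K\alpha^{-1}\delta)^{-1}\alpha^{-1}\bigr)}{1+\sqrt{1-2K\alpha^{-1}\delta}}.$$ Then the perturbed equation $\dot x=[A(t)+B(t)]x$ has an exponential dichotomy on $J$ with a projection $Q(t)$ of the same rank as $P(t)$ and with constants $L$, $\beta$, such that $$|Q(t)-P(t)|\le 2KL(\alpha+\beta)^{-1}\delta\qquad\text{for all } t\in J.$$ -/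

import Mathlib

open Set Filter Topology

/-- `A` is piecewise continuous on the interval `J`: it has only finitely many points of
discontinuity in every bounded part of `J`, and one-sided limits (from within `J`) at every point
of `J`. At an endpoint of `J` one of the two limits is along the trivial filter, so it imposes
nothing. Values of `A` outside `J` play no role. -/
def PiecewiseContinuousOn {F : Type*} [TopologicalSpace F] (A : ℝ → F) (J : Set ℝ) : Prop :=
  (∀ c d : ℝ, {t ∈ J ∩ Icc c d | ¬ ContinuousWithinAt A J t}.Finite) ∧
    ∀ t ∈ J, (∃ l, Tendsto A (𝓝[J ∩ Iio t] t) (𝓝 l)) ∧ (∃ l, Tendsto A (𝓝[J ∩ Ioi t] t) (𝓝 l))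

/-- `Φ` is the transition operator (evolution family) on `J` of the linear differential equation
`x' = A(t) x` with piecewise continuous `A`: for every initial time `s ∈ J` the function
`t ↦ Φ t s` is continuous on `J`, satisfies `Φ s s = 1`, and satisfies the equation at every point
of `J` at which `A` is continuous (one-sided derivatives are meant at an endpoint of `J`).
Products of operators are compositions. -/
structure IsTransitionOperator {E : Type*} [NormedAddCommGroup E] [NormedSpace ℝ E]
    (A : ℝ → E →L[ℝ] E) (J : Set ℝ) (Φ : ℝ → ℝ → E →L[ℝ] E) : Prop where
  initial : ∀ s ∈ J, Φ s s = 1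
  continuousOn : ∀ s ∈ J, ContinuousOn (fun t => Φ t s) J
  deriv_eq : ∀ s ∈ J, ∀ t ∈ J, ContinuousWithinAt A J t →
    HasDerivWithinAt (fun t => Φ t s) (A t * Φ t s) J t

/-- The equation `x' = A(t) x` has an exponential dichotomy on `J` with projection function `P`
and constants `K`, `α`. Since `Φ t s` is defined for all `t, s` in `J`, in either order, `Φ s t` is
the inverse of `Φ t s`, and there is no separate invertibility condition on the null spaces. -/
def HasExpDichotomy {E : Type*} [NormedAddCommGroup E] [NormedSpace ℝ E]
    (A : ℝ → E →L[ℝ] E) (J : Set ℝ) (P : ℝ → E →L[ℝ] E) (K α : ℝ) : Prop :=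
  1 ≤ K ∧ 0 < α ∧
  (∀ t ∈ J, P t * P t = P t) ∧
  (∀ s ∈ J, ∀ t ∈ J, Module.finrank ℝ (P t).range = Module.finrank ℝ (P s).range) ∧
  ∃ Φ : ℝ → ℝ → E →L[ℝ] E, IsTransitionOperator A J Φ ∧
    (∀ s ∈ J, ∀ t ∈ J, Φ t s * P s = P t * Φ t s) ∧
    (∀ s ∈ J, ∀ t ∈ J, s ≤ t → ‖Φ t s * P s‖ ≤ K * Real.exp (-α * (t - s))) ∧
    (∀ s ∈ J, ∀ t ∈ J, s ≤ t → ‖Φ s t * (1 - P t)‖ ≤ K * Real.exp (-α * (t - s)))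

/-! The idea is to perturb Green's function rather than the projection. Let G(t,s) be Φ(t,s)P(s) for
t ≥ s and -Φ(t,s)(I-P(s)) for t < s; the dichotomy says |G(t,s)| ≤ K e^{-α|t-s|}. Green's function
of the perturbed equation should solve F = G(·,s) + ∫_J G(·,u)B(u)F(u) du. With r = √(1-2Kδ/α), the
function (K/r)e^{-αr|t-s|} solves exactly the scalar majorant equation on the whole line
(`exp_supersolution`). So the Neumann series converges under this bound (`neumann_series`,
`exists_perturbed_green`), which has rate αr = β and constant K/r ≤ L.

Put Q(s) = F_s(s). Variation of constants gives F_s(t) = Ψ(t,s)Q(s) for t ≥ s and -Ψ(t,s)(I-Q(s))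
for t < s (`perturbedGreen_eq`), so off the diagonal the bound on F is the pair of dichotomy
estimates. The algebra of Q comes from uniqueness: as 2Kδ/α < 1, a bounded solution of the
homogeneous integral equation vanishes. Comparing suitable bounded solutions yields Q² = Q
(`perturbedGreen_idem`) and invariance under Ψ (`perturbedGreen_comm`). The same contraction on
single vectors makes P(s) injective on the range of Q(s) and conversely, so the ranks agree. Finally
Q-P is the integral term on the diagonal, at most K/r-K. -/

/-! ### Integrals of two-sided exponentials -/

-- Cut at s and t: the outer pieces become explicit after multiplication by a+b, the middle one
-- after multiplication by a-b. The factor a²-b² is kept on the left so that a = b needs no separate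
-- case.
open MeasureTheory in
theorem integral_exp_neg_abs_mul_of_le {a b s t : ℝ} (hab : 0 < a + b)
    (hst : s ≤ t) :
    Integrable (fun u => Real.exp (-a * |t - u|) * Real.exp (-b * |u - s|)) ∧
    (a ^ 2 - b ^ 2) * ∫ u, Real.exp (-a * |t - u|) * Real.exp (-b * |u - s|) =
      2 * (a * Real.exp (-b * |t - s|) - b * Real.exp (-a * |t - s|)) := by
  set f : ℝ → ℝ := fun u => Real.exp (-a * |t - u|) * Real.exp (-b * |u - s|) with hf
  have e1 : EqOn f (fun u => Real.exp (-a * t - b * s) * Real.exp ((a + b) * u)) (Iic s) := by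
    intro u hu
    have hu : u ≤ s := hu
    simp only [hf]
    rw [abs_of_nonneg (by linarith : 0 ≤ t - u), abs_of_nonpos (by linarith : u - s ≤ 0),
      ← Real.exp_add, ← Real.exp_add]
    ring_nf
  have e2 : EqOn f (fun u => Real.exp (-a * (t - u) - b * (u - s))) (uIcc s t) := by
    intro u hu
    rw [uIcc_of_le hst] at hu
    simp only [hf]
    rw [abs_of_nonneg (by linarith [hu.2] : 0 ≤ t - u),
      abs_of_nonneg (by linarith [hu.1] : 0 ≤ u - s), ← Real.exp_add]
    ring_nf
  have e3 : EqOn f (fun u => Real.exp (a * t + b * s) * Real.exp (-(a + b) * u)) (Ioi t) := by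
    intro u hu
    have hu : t < u := hu
    simp only [hf]
    rw [abs_of_nonpos (by linarith : t - u ≤ 0), abs_of_nonneg (by linarith : 0 ≤ u - s),
      ← Real.exp_add, ← Real.exp_add]
    ring_nf
  have i1 : IntegrableOn f (Iic s) :=
    IntegrableOn.congr_fun ((integrableOn_exp_mul_Iic hab s).const_mul _) e1.symm measurableSet_Iic
  have hfc : Continuous f := by fun_prop
  have i2 : IntervalIntegrable f volume s t := hfc.intervalIntegrable _ _
  have i3 : IntegrableOn f (Ioi t) :=
    IntegrableOn.congr_fun ((integrableOn_exp_mul_Ioi (by linarith : -(a + b) < 0) t).const_mul _)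
      e3.symm measurableSet_Ioi
  have i4 : IntegrableOn f (Ioi s) := by
    rw [← Ioc_union_Ioi_eq_Ioi hst]
    exact ((intervalIntegrable_iff_integrableOn_Ioc_of_le hst).1 i2).union i3
  have i5 : Integrable f := by
    rw [← integrableOn_univ, ← Iic_union_Ioi (a := s)]
    exact i1.union i4
  refine ⟨i5, ?_⟩
  have v1 : (a + b) * ∫ u in Iic s, f u = Real.exp (-a * (t - s)) := by
    rw [setIntegral_congr_fun measurableSet_Iic e1, integral_const_mul, integral_exp_mul_Iic hab]
    field_simp
    rw [← Real.exp_add]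
    ring_nf
  have v3 : (a + b) * ∫ u in Ioi t, f u = Real.exp (-b * (t - s)) := by
    rw [setIntegral_congr_fun measurableSet_Ioi e3, integral_const_mul,
      integral_exp_mul_Ioi (by linarith : -(a + b) < 0)]
    have : a + b ≠ 0 := hab.ne'
    rw [neg_div_neg_eq, mul_div_assoc', ← Real.exp_add, mul_div_assoc', mul_comm (a + b),
      mul_div_assoc, div_self this]
    ring_nf
  have v2 : (a - b) * ∫ u in s..t, f u = Real.exp (-b * (t - s)) - Real.exp (-a * (t - s)) := by
    rw [intervalIntegral.integral_congr e2, ← intervalIntegral.integral_const_mul]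
    have hd : ∀ u ∈ uIcc s t, HasDerivAt (fun u => Real.exp (-a * (t - u) - b * (u - s)))
        ((a - b) * Real.exp (-a * (t - u) - b * (u - s))) u := by
      intro u _
      have h1 : HasDerivAt (fun u : ℝ => -a * (t - u) - b * (u - s)) (a - b) u := by
        have := (((hasDerivAt_id u).const_sub t).const_mul (-a)).sub
          (((hasDerivAt_id u).sub_const s).const_mul b)
        convert! this using 1
        ring
      convert! h1.exp using 1
      ring
    rw [intervalIntegral.integral_eq_sub_of_hasDerivAt hd
      (Continuous.intervalIntegrable (by fun_prop) _ _)]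
    congr 2 <;> ring
  have hs : ∫ u, f u = (∫ u in Iic s, f u) + ((∫ u in s..t, f u) + ∫ u in Ioi t, f u) := by
    rw [intervalIntegral.integral_interval_add_Ioi i4 i3, intervalIntegral.integral_Iic_add_Ioi i1 i4]
  rw [hs, abs_of_nonneg (by linarith : 0 ≤ t - s)]
  linear_combination (a - b) * v1 + (a + b) * v2 + (a - b) * v3

open MeasureTheory in
/-- The convolution of two two-sided exponentials. -/
theorem integral_exp_neg_abs_mul {a b : ℝ} (hab : 0 < a + b) (s t : ℝ) :
    Integrable (fun u => Real.exp (-a * |t - u|) * Real.exp (-b * |u - s|)) ∧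
    (a ^ 2 - b ^ 2) * ∫ u, Real.exp (-a * |t - u|) * Real.exp (-b * |u - s|) =
      2 * (a * Real.exp (-b * |t - s|) - b * Real.exp (-a * |t - s|)) := by
  rcases le_total s t with h | h
  · exact integral_exp_neg_abs_mul_of_le hab h
  · obtain ⟨h1, h2⟩ := integral_exp_neg_abs_mul_of_le (b := a) (a := b) (by linarith) h
    have e : (fun u => Real.exp (-b * |s - u|) * Real.exp (-a * |u - t|)) =
        fun u => Real.exp (-a * |t - u|) * Real.exp (-b * |u - s|) := by
      ext u
      rw [mul_comm, abs_sub_comm u t, abs_sub_comm s u]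
    rw [e] at h1 h2
    refine ⟨h1, ?_⟩
    rw [abs_sub_comm t s]
    linarith

open MeasureTheory in
theorem integral_exp_neg_abs {a : ℝ} (ha : 0 < a) (t : ℝ) :
    Integrable (fun u => Real.exp (-a * |t - u|)) ∧ ∫ u, Real.exp (-a * |t - u|) = 2 / a := by
  obtain ⟨h1, h2⟩ := integral_exp_neg_abs_mul (a := a) (b := 0) (by linarith) t t
  simp only [neg_zero, zero_mul, Real.exp_zero, mul_one, sub_self, abs_zero, mul_zero,
    sub_zero, ne_eq, OfNat.ofNat_ne_zero, not_false_eq_true, zero_pow] at h1 h2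
  refine ⟨h1, ?_⟩
  rw [eq_div_iff ha.ne']
  apply mul_left_cancel₀ ha.ne'
  linarith

/-! ### Contraction and Neumann series -/

/-- If every upper bound of a bounded function can be improved by a factor `q < 1`, then the
function is nonpositive. -/
theorem nonpos_of_bound_improves {J : Set ℝ} {q M : ℝ} (hq : 0 ≤ q) (hq1 : q < 1) {g : ℝ → ℝ}
    (hM : ∀ t ∈ J, g t ≤ M)
    (hg : ∀ N, 0 ≤ N → (∀ u ∈ J, g u ≤ N) → ∀ t ∈ J, g t ≤ q * N) :
    ∀ t ∈ J, g t ≤ 0 := by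
  have key : ∀ n : ℕ, ∀ t ∈ J, g t ≤ q ^ n * |M| := by
    intro n
    induction n with
    | zero => intro t ht; simpa using (hM t ht).trans (le_abs_self M)
    | succ n ih =>
      intro t ht
      refine (hg _ (by positivity) ih t ht).trans_eq ?_
      ring
  intro t ht
  have hlim : Tendsto (fun n : ℕ => q ^ n * |M|) atTop (𝓝 (0 * |M|)) :=
    (tendsto_pow_atTop_nhds_zero_of_lt_one hq hq1).mul_const _
  rw [zero_mul] at hlim
  exact ge_of_tendsto' hlim fun n => key n t ht

open MeasureTheory in
/-- The Neumann series of a linear integral equation whose kernel is dominated by a scalar kernel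
with a supersolution `v`: it converges absolutely, is bounded by `v`, and solves the equation. -/
theorem neumann_series {X : Type*} [NormedAddCommGroup X] [NormedSpace ℝ X] [CompleteSpace X]
    {S : Set ℝ} {μ : ℝ → Measure ℝ} (hμ : ∀ t ∈ S, ∀ᵐ u ∂μ t, u ∈ S)
    {k : ℝ → ℝ → X → X} {κ : ℝ → ℝ → ℝ} {v : ℝ → ℝ} {F : ℕ → ℝ → X}
    (hκ : ∀ t u, 0 ≤ κ t u) (hv0 : ∀ t ∈ S, 0 ≤ v t)
    (hk : ∀ t ∈ S, ∀ u ∈ S, ∀ x, ‖k t u x‖ ≤ κ t u * ‖x‖)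
    (hk0 : ∀ t ∈ S, ∀ u ∈ S, ∀ f : ℕ → X, ∀ x, HasSum f x →
      HasSum (fun n => k t u (f n)) (k t u x))
    (hF : ∀ n, ∀ t ∈ S, F (n + 1) t = ∫ u, k t u (F n u) ∂μ t)
    (hm : ∀ n, ∀ t ∈ S, AEStronglyMeasurable (fun u => k t u (F n u)) (μ t))
    (hκm : ∀ n, ∀ t ∈ S, AEStronglyMeasurable (fun u => κ t u * ‖F n u‖) (μ t))
    (hi : ∀ t ∈ S, Integrable (fun u => κ t u * v u) (μ t))
    (hv : ∀ t ∈ S, ‖F 0 t‖ + ∫ u, κ t u * v u ∂μ t ≤ v t) :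
    ∀ t ∈ S, HasSum (fun n => F n t) (∑' n, F n t) ∧ ‖∑' n, F n t‖ ≤ v t ∧
      ∑' n, F n t = F 0 t + ∫ u, k t u (∑' n, F n u) ∂μ t := by
  have hvm : ∀ n, (∀ u ∈ S, ∑ i ∈ Finset.range n, ‖F i u‖ ≤ v u) → ∀ t ∈ S,
      Integrable (fun u => κ t u * ∑ i ∈ Finset.range n, ‖F i u‖) (μ t) := by
    intro n hn t ht
    refine (hi t ht).mono' ?_ ?_
    · simp only [Finset.mul_sum]
      exact Finset.aestronglyMeasurable_fun_sum _ fun i _ => hκm i t ht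
    · filter_upwards [hμ t ht] with u hu
      rw [Real.norm_of_nonneg (mul_nonneg (hκ _ _) (Finset.sum_nonneg fun _ _ => norm_nonneg _))]
      exact mul_le_mul_of_nonneg_left (hn u hu) (hκ _ _)
  -- A partial sum of norms is at most ‖F 0‖ plus the scalar kernel applied to the previous partial
  -- sum, so the supersolution inequality propagates the bound v.
  have hps : ∀ n, ∀ t ∈ S, ∑ i ∈ Finset.range n, ‖F i t‖ ≤ v t := by
    intro n
    induction n with
    | zero =>
      intro t ht
      simpa using hv0 t ht
    | succ n ih =>
      intro t ht
      rw [Finset.sum_range_succ']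
      refine le_trans ?_ (hv t ht)
      rw [add_comm]
      gcongr
      have hint : ∀ i ∈ Finset.range n, Integrable (fun u => κ t u * ‖F i u‖) (μ t) := by
        intro i hi'
        refine (hvm n ih t ht).mono' (hκm i t ht) (Eventually.of_forall fun u => ?_)
        rw [Real.norm_of_nonneg (mul_nonneg (hκ _ _) (norm_nonneg _))]
        exact mul_le_mul_of_nonneg_left
          (Finset.single_le_sum (f := fun i => ‖F i u‖) (fun _ _ => norm_nonneg _) hi') (hκ _ _)
      calc ∑ i ∈ Finset.range n, ‖F (i + 1) t‖
          ≤ ∑ i ∈ Finset.range n, ∫ u, κ t u * ‖F i u‖ ∂μ t := by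
            refine Finset.sum_le_sum fun i hi' => ?_
            rw [hF i t ht]
            refine norm_integral_le_of_norm_le (hint i hi') ?_
            filter_upwards [hμ t ht] with u hu
            exact hk t ht u hu _
        _ = ∫ u, κ t u * ∑ i ∈ Finset.range n, ‖F i u‖ ∂μ t := by
            rw [← integral_finsetSum _ hint]
            simp only [Finset.mul_sum]
        _ ≤ ∫ u, κ t u * v u ∂μ t := by
            refine integral_mono_ae (hvm n ih t ht) (hi t ht) ?_
            filter_upwards [hμ t ht] with u hu
            exact mul_le_mul_of_nonneg_left (ih u hu) (hκ _ _)
  have hsn : ∀ t ∈ S, Summable fun n => ‖F n t‖ := fun t ht =>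
    summable_of_sum_range_le (fun _ => norm_nonneg _) fun n => hps n t ht
  have hnv : ∀ t ∈ S, ∑' n, ‖F n t‖ ≤ v t := fun t ht =>
    Real.tsum_le_of_sum_range_le (fun _ => norm_nonneg _) fun n => hps n t ht
  intro t ht
  have hs : HasSum (fun n => F n t) (∑' n, F n t) := (hsn t ht).of_norm.hasSum
  refine ⟨hs, (norm_tsum_le_tsum_norm (hsn t ht)).trans (hnv t ht), ?_⟩
  have hint : HasSum (fun n => ∫ u, k t u (F n u) ∂μ t) (∫ u, k t u (∑' n, F n u) ∂μ t) := by
    refine hasSum_integral_of_dominated_convergence (fun n u => κ t u * ‖F n u‖)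
      (fun n => hm n t ht) (fun n => ?_) ?_ ?_ ?_
    · filter_upwards [hμ t ht] with u hu
      exact hk t ht u hu _
    · filter_upwards [hμ t ht] with u hu
      exact (hsn u hu).mul_left _
    · refine (hi t ht).mono' ?_ ?_
      · refine aestronglyMeasurable_of_tendsto_ae atTop
          (f := fun n u => ∑ i ∈ Finset.range n, κ t u * ‖F i u‖)
          (fun n => Finset.aestronglyMeasurable_fun_sum _ fun i _ => hκm i t ht) ?_
        filter_upwards [hμ t ht] with u hu
        exact ((hsn u hu).mul_left _).hasSum.tendsto_sum_nat
      · filter_upwards [hμ t ht] with u hu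
        rw [tsum_mul_left, Real.norm_of_nonneg
          (mul_nonneg (hκ _ _) (tsum_nonneg fun _ => norm_nonneg _))]
        exact mul_le_mul_of_nonneg_left (hnv u hu) (hκ _ _)
    · filter_upwards [hμ t ht] with u hu
      exact hk0 t ht u hu _ _ (hsn u hu).of_norm.hasSum
  rw [hs.summable.tsum_eq_zero_add]
  congr 1
  rw [← hint.tsum_eq]
  exact tsum_congr fun n => hF n t ht

/-! ### Locally bounded functions and their primitives -/

open MeasureTheory in
/-- `f` is measurable on `J` and bounded on the bounded parts of `J`. -/
structure LocallyBoundedOn {F : Type*} [NormedAddCommGroup F] (f : ℝ → F) (J : Set ℝ) : Prop where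
  aesm : AEStronglyMeasurable f (volume.restrict J)
  bdd : ∀ a b, ∃ M, ∀ t ∈ J ∩ Icc a b, ‖f t‖ ≤ M

namespace LocallyBoundedOn

open MeasureTheory

variable {F : Type*} [NormedAddCommGroup F] {J : Set ℝ} {f g : ℝ → F}

theorem of_continuousOn (hJ : IsClosed J) (hf : ContinuousOn f J) : LocallyBoundedOn f J where
  aesm := hf.aestronglyMeasurable hJ.measurableSet
  bdd a b := by
    have hc : IsCompact (J ∩ Icc a b) := isCompact_Icc.inter_left hJ
    exact hc.exists_bound_of_continuousOn (hf.mono inter_subset_left)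

theorem add (hf : LocallyBoundedOn f J) (hg : LocallyBoundedOn g J) :
    LocallyBoundedOn (fun t => f t + g t) J where
  aesm := hf.aesm.add hg.aesm
  bdd a b := by
    obtain ⟨M, hM⟩ := hf.bdd a b
    obtain ⟨N, hN⟩ := hg.bdd a b
    exact ⟨M + N, fun t ht => (norm_add_le _ _).trans (add_le_add (hM t ht) (hN t ht))⟩

theorem neg (hf : LocallyBoundedOn f J) : LocallyBoundedOn (fun t => -f t) J where
  aesm := hf.aesm.neg
  bdd a b := by
    obtain ⟨M, hM⟩ := hf.bdd a b
    exact ⟨M, fun t ht => by simpa using hM t ht⟩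

theorem sub (hf : LocallyBoundedOn f J) (hg : LocallyBoundedOn g J) :
    LocallyBoundedOn (fun t => f t - g t) J := by
  simpa [sub_eq_add_neg] using hf.add hg.neg

theorem mul {R : Type*} [NormedRing R] {f g : ℝ → R} (hf : LocallyBoundedOn f J)
    (hg : LocallyBoundedOn g J) : LocallyBoundedOn (fun t => f t * g t) J where
  aesm := hf.aesm.mul hg.aesm
  bdd a b := by
    obtain ⟨M, hM⟩ := hf.bdd a b
    obtain ⟨N, hN⟩ := hg.bdd a b
    exact ⟨M * N, fun t ht => (norm_mul_le _ _).trans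
      (mul_le_mul (hM t ht) (hN t ht) (norm_nonneg _) ((norm_nonneg _).trans (hM t ht)))⟩

theorem clm_apply {G : Type*} [NormedAddCommGroup G] [NormedSpace ℝ G] [NormedSpace ℝ F]
    {f : ℝ → F →L[ℝ] G} (hf : LocallyBoundedOn f J)
    (hg : LocallyBoundedOn g J) : LocallyBoundedOn (fun t => f t (g t)) J where
  aesm := by
    have h : Continuous fun p : (F →L[ℝ] G) × F => p.1 p.2 := by fun_prop
    exact h.comp_aestronglyMeasurable (hf.aesm.prodMk hg.aesm)
  bdd a b := by
    obtain ⟨M, hM⟩ := hf.bdd a b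
    obtain ⟨N, hN⟩ := hg.bdd a b
    exact ⟨M * N, fun t ht => (ContinuousLinearMap.le_opNorm _ _).trans
      (mul_le_mul (hM t ht) (hN t ht) (norm_nonneg _) ((norm_nonneg _).trans (hM t ht)))⟩

theorem clm_comp {G : Type*} [NormedAddCommGroup G] [NormedSpace ℝ G] [NormedSpace ℝ F]
    (L : F →L[ℝ] G) (hf : LocallyBoundedOn f J) : LocallyBoundedOn (fun t => L (f t)) J where
  aesm := L.continuous.comp_aestronglyMeasurable hf.aesm
  bdd a b := by
    obtain ⟨M, hM⟩ := hf.bdd a b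
    exact ⟨‖L‖ * M, fun t ht => (L.le_opNorm _).trans
      (mul_le_mul_of_nonneg_left (hM t ht) (norm_nonneg _))⟩

theorem ite {p : ℝ → Prop} [DecidablePred p] (hp : MeasurableSet {t | p t})
    (hf : LocallyBoundedOn f J) : LocallyBoundedOn (fun t => if p t then f t else 0) J where
  aesm := by
    have : (fun t => if p t then f t else 0) = indicator {t | p t} f := by
      ext t; simp [indicator]
    rw [this]
    exact hf.aesm.indicator hp
  bdd a b := by
    obtain ⟨M, hM⟩ := hf.bdd a b
    refine ⟨M, fun t ht => ?_⟩
    have h := hM t ht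
    split_ifs
    · exact h
    · simpa using (norm_nonneg _).trans h

theorem intervalIntegrable (hJ : J.OrdConnected) (hf : LocallyBoundedOn f J) {s t : ℝ}
    (hs : s ∈ J) (ht : t ∈ J) : IntervalIntegrable f volume s t := by
  have hsub : uIoc s t ⊆ J := uIoc_subset_uIcc.trans (hJ.uIcc_subset hs ht)
  obtain ⟨M, hM⟩ := hf.bdd (min s t) (max s t)
  rw [intervalIntegrable_iff]
  refine IntegrableOn.of_bound (C := M) (by simp [uIoc]) (hf.aesm.mono_measure
    (Measure.restrict_mono hsub le_rfl)) ?_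
  filter_upwards [ae_restrict_mem measurableSet_uIoc] with u hu
  exact hM u ⟨hsub hu, uIoc_subset_uIcc hu⟩

variable [NormedSpace ℝ F]

/-- Continuity is needed only at the one point t and within J, which accommodates jumps of the
coefficients elsewhere and endpoints of J. -/
theorem integral_hasDerivWithinAt [CompleteSpace F] (hJ : J.OrdConnected)
    (hf : LocallyBoundedOn f J)
    {s t : ℝ} (hs : s ∈ J) (ht : t ∈ J) (hc : ContinuousWithinAt f J t) :
    HasDerivWithinAt (fun t => ∫ u in s..t, f u) (f t) J t := by
  rw [hasDerivWithinAt_iff_isLittleO, Asymptotics.isLittleO_iff]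
  intro c hc0
  obtain ⟨d, hd, hd'⟩ := Metric.continuousWithinAt_iff.1 hc c hc0
  filter_upwards [self_mem_nhdsWithin, mem_nhdsWithin_of_mem_nhds (Metric.ball_mem_nhds t hd)]
    with r hr hrd
  have e : (∫ u in s..r, f u) - (∫ u in s..t, f u) - (r - t) • f t
      = ∫ u in t..r, (f u - f t) := by
    rw [intervalIntegral.integral_sub (hf.intervalIntegrable hJ ht hr) (by simp),
      intervalIntegral.integral_const, intervalIntegral.integral_interval_sub_left
        (hf.intervalIntegrable hJ hs hr) (hf.intervalIntegrable hJ hs ht)]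
  rw [e]
  refine intervalIntegral.norm_integral_le_of_norm_le_const fun u hu => ?_
  have hu' := uIoc_subset_uIcc hu
  rw [← dist_eq_norm]
  refine (hd' (hJ.uIcc_subset ht hr hu') ?_).le
  have : |u - t| ≤ |r - t| := abs_sub_left_of_mem_uIcc hu'
  rw [Real.dist_eq]
  rw [Metric.mem_ball, Real.dist_eq] at hrd
  linarith

theorem integral_continuousOn (hJ : J.OrdConnected) (hf : LocallyBoundedOn f J)
    {s : ℝ} (hs : s ∈ J) : ContinuousOn (fun t => ∫ u in s..t, f u) J := by
  intro t ht
  obtain ⟨M, hM⟩ := hf.bdd (t - 1) (t + 1)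
  have hlim : Tendsto (fun r => M * |r - t|) (𝓝[J] t) (𝓝 0) := by
    have : Continuous fun r => M * |r - t| := by fun_prop
    simpa using (this.tendsto t).mono_left nhdsWithin_le_nhds
  rw [ContinuousWithinAt, tendsto_iff_norm_sub_tendsto_zero]
  refine squeeze_zero' (Eventually.of_forall fun _ => norm_nonneg _) ?_ hlim
  filter_upwards [self_mem_nhdsWithin,
    mem_nhdsWithin_of_mem_nhds (Metric.ball_mem_nhds t one_pos)] with r hr hr1
  rw [intervalIntegral.integral_interval_sub_left
        (hf.intervalIntegrable hJ hs hr) (hf.intervalIntegrable hJ hs ht)]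
  refine intervalIntegral.norm_integral_le_of_norm_le_const fun u hu => ?_
  have hu' := uIoc_subset_uIcc hu
  have : |u - t| ≤ |r - t| := abs_sub_left_of_mem_uIcc hu'
  rw [Metric.mem_ball, Real.dist_eq] at hr1
  have h3 := abs_le.1 (this.trans hr1.le)
  exact hM u ⟨hJ.uIcc_subset ht hr hu', by linarith [h3.1], by linarith [h3.2]⟩

end LocallyBoundedOn

/-! ### Calculus off a countable set; piecewise continuous coefficients -/

open MeasureTheory in
theorem integral_eq_sub_of_hasDerivWithinAt_off_countable {X : Type*} [NormedAddCommGroup X]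
    [NormedSpace ℝ X] [CompleteSpace X] {J D : Set ℝ} (hJ : J.OrdConnected) (hD : D.Countable)
    {f f' : ℝ → X} (hf : ContinuousOn f J) (hf' : LocallyBoundedOn f' J)
    (hd : ∀ t ∈ J \ D, HasDerivWithinAt f (f' t) J t) {s t : ℝ} (hs : s ∈ J) (ht : t ∈ J) :
    ∫ u in s..t, f' u = f t - f s := by
  have hsub := hJ.uIcc_subset hs ht
  refine integral_eq_of_hasDerivAt_off_countable f f' hD (hf.mono hsub) (fun x hx => ?_)
    (hf'.intervalIntegrable hJ hs ht)
  have hx' : Ioo (min s t) (max s t) ⊆ J := Ioo_subset_Icc_self.trans hsub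
  exact (hd x ⟨hx' hx.1, hx.2⟩).hasDerivAt (mem_of_superset (isOpen_Ioo.mem_nhds hx.1) hx')

theorem eq_of_hasDerivWithinAt_zero_off_countable {X : Type*} [NormedAddCommGroup X]
    [NormedSpace ℝ X] [CompleteSpace X] {J D : Set ℝ} (hJ : J.OrdConnected) (hD : D.Countable)
    {f : ℝ → X} (hf : ContinuousOn f J)
    (hd : ∀ t ∈ J \ D, HasDerivWithinAt f 0 J t) {s t : ℝ} (hs : s ∈ J) (ht : t ∈ J) :
    f t = f s := by
  have := integral_eq_sub_of_hasDerivWithinAt_off_countable hJ hD hf (f' := fun _ => 0)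
    ⟨by fun_prop, fun _ _ => ⟨0, by simp⟩⟩ hd hs ht
  rw [intervalIntegral.integral_zero] at this
  exact (sub_eq_zero.1 this.symm)

open MeasureTheory in
theorem PiecewiseContinuousOn.countable_discontinuities {F : Type*} [TopologicalSpace F]
    {C : ℝ → F} {J : Set ℝ} (hC : PiecewiseContinuousOn C J) :
    {t ∈ J | ¬ContinuousWithinAt C J t}.Countable := by
  refine (countable_iUnion fun n : ℕ => (hC.1 (-n) n).countable).mono ?_
  rintro t ⟨ht, hc⟩
  obtain ⟨n, hn⟩ := exists_nat_ge |t|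
  exact mem_iUnion.2 ⟨n, ⟨ht, abs_le.1 hn⟩, hc⟩

-- Measurability holds because the discontinuities form a null set. Boundedness is local, from the
-- two one-sided limits and the value at the point, and then follows by compactness.
open MeasureTheory in
theorem PiecewiseContinuousOn.locallyBoundedOn {F : Type*} [NormedAddCommGroup F]
    {C : ℝ → F} {J : Set ℝ} (hJ : IsClosed J) (hC : PiecewiseContinuousOn C J) :
    LocallyBoundedOn C J where
  aesm := by
    set D := {t ∈ J | ¬ContinuousWithinAt C J t}
    have hD : D.Countable := hC.countable_discontinuities
    have h1 : ContinuousOn C (J \ D) := by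
      intro t ht
      have : ContinuousWithinAt C J t := by
        by_contra h
        exact ht.2 ⟨ht.1, h⟩
      exact this.mono sdiff_subset
    have h2 := h1.aestronglyMeasurable (μ := volume) (hJ.measurableSet.diff hD.measurableSet)
    rwa [Measure.restrict_congr_set (sdiff_null_ae_eq_self (hD.measure_zero volume))] at h2
  bdd a b := by
    have hc : IsCompact (J ∩ Icc a b) := isCompact_Icc.inter_left hJ
    refine hc.induction_on (p := fun s => ∃ M, ∀ t ∈ s, ‖C t‖ ≤ M) ⟨0, by simp⟩
      (fun s t hst ⟨M, hM⟩ => ⟨M, fun u hu => hM u (hst hu)⟩) ?_ ?_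
    · rintro s t ⟨M, hM⟩ ⟨N, hN⟩
      refine ⟨max M N, fun u hu => ?_⟩
      rcases hu with hu | hu
      · exact (hM u hu).trans (le_max_left _ _)
      · exact (hN u hu).trans (le_max_right _ _)
    · intro t ht
      obtain ⟨⟨l, hl⟩, ⟨r, hr⟩⟩ := hC.2 t ht.1
      have h1 : ∀ᶠ u in 𝓝[J ∩ Iio t] t, ‖C u‖ ≤ ‖l‖ + 1 :=
        (hl.norm.eventually (gt_mem_nhds (by linarith))).mono fun _ h => h.le
      have h2 : ∀ᶠ u in 𝓝[J ∩ Ioi t] t, ‖C u‖ ≤ ‖r‖ + 1 :=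
        (hr.norm.eventually (gt_mem_nhds (by linarith))).mono fun _ h => h.le
      rw [eventually_nhdsWithin_iff] at h1 h2
      refine ⟨{u ∈ J | ‖C u‖ ≤ max (‖C t‖) (max (‖l‖ + 1) (‖r‖ + 1))}, ?_, _, fun u hu => hu.2⟩
      refine nhdsWithin_mono t inter_subset_left ?_
      filter_upwards [self_mem_nhdsWithin, mem_nhdsWithin_of_mem_nhds h1,
        mem_nhdsWithin_of_mem_nhds h2] with u hu hu1 hu2
      refine ⟨hu, ?_⟩
      rcases lt_trichotomy u t with h | h | h
      · exact (hu1 ⟨hu, h⟩).trans ((le_max_left _ _).trans (le_max_right _ _))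
      · rw [h]; exact le_max_left _ _
      · exact (hu2 ⟨hu, h⟩).trans ((le_max_right _ _).trans (le_max_right _ _))

/-! ### Linear Volterra equations -/

-- This identity makes ‖x₀‖e^{M|t-s|} an exact solution of the scalar majorant of the Volterra
-- equation.
open MeasureTheory in
theorem setIntegral_uIoc_mul_exp_abs (M s t : ℝ) :
    ∫ u in uIoc s t, M * Real.exp (M * |u - s|) = Real.exp (M * |t - s|) - 1 := by
  rcases le_total s t with h | h
  · rw [uIoc_of_le h, ← intervalIntegral.integral_of_le h]
    have e : EqOn (fun u => M * Real.exp (M * |u - s|)) (fun u => M * Real.exp (M * (u - s)))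
        (uIcc s t) := by
      intro u hu
      rw [uIcc_of_le h] at hu
      simp only [abs_of_nonneg (sub_nonneg.2 hu.1)]
    have hd : ∀ u ∈ uIcc s t, HasDerivAt (fun u => Real.exp (M * (u - s)))
        (M * Real.exp (M * (u - s))) u := by
      intro u _
      convert! (((hasDerivAt_id u).sub_const s).const_mul M).exp using 1
      simp [mul_comm]
    rw [intervalIntegral.integral_congr e, intervalIntegral.integral_eq_sub_of_hasDerivAt hd
      (Continuous.intervalIntegrable (by fun_prop) _ _), abs_of_nonneg (sub_nonneg.2 h)]
    simp
  · rw [uIoc_of_ge h, ← intervalIntegral.integral_of_le h]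
    have e : EqOn (fun u => M * Real.exp (M * |u - s|)) (fun u => M * Real.exp (M * (s - u)))
        (uIcc t s) := by
      intro u hu
      rw [uIcc_of_le h] at hu
      simp only [abs_of_nonpos (sub_nonpos.2 hu.2), neg_sub]
    have hd : ∀ u ∈ uIcc t s, HasDerivAt (fun u => -Real.exp (M * (s - u)))
        (M * Real.exp (M * (s - u))) u := by
      intro u _
      convert! (((hasDerivAt_id u).const_sub s).const_mul M).exp.neg using 1
      simp [mul_comm]
    rw [intervalIntegral.integral_congr e, intervalIntegral.integral_eq_sub_of_hasDerivAt hd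
      (Continuous.intervalIntegrable (by fun_prop) _ _), abs_of_nonpos (sub_nonpos.2 h)]
    simp
    ring

open MeasureTheory in
/-- Global solvability of linear Volterra equations with locally bounded coefficients. -/
theorem exists_volterra_solution {X : Type*} [NormedAddCommGroup X] [NormedSpace ℝ X]
    [CompleteSpace X] {J : Set ℝ} (hJc : IsClosed J) (hJ : J.OrdConnected) {C : ℝ → X →L[ℝ] X}
    (hC : LocallyBoundedOn C J) (x₀ : X) {s : ℝ} (hs : s ∈ J) :
    ∃ y : ℝ → X, ContinuousOn y J ∧ ∀ t ∈ J, y t = x₀ + ∫ u in s..t, C u (y u) := by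
  set F : ℕ → ℝ → X := fun n => Nat.rec (fun _ => x₀) (fun _ f t => ∫ u in s..t, C u (f u)) n
   
  have hF0 : F 0 = fun _ => x₀ := rfl
  have hFs : ∀ n, F (n + 1) = fun t => ∫ u in s..t, C u (F n u) := fun n => rfl
  have hFc : ∀ n, ContinuousOn (F n) J := by
    intro n
    induction n with
    | zero => exact continuousOn_const
    | succ n ih =>
      exact (hC.clm_apply (.of_continuousOn hJc ih)).integral_continuousOn hJ hs
  -- The bound M on the coefficient depends on the compact interval between s and a, but the series
  -- does not, so the local solutions agree automatically.
  have main : ∀ a ∈ J, ∃ M, ∀ t ∈ uIcc s a, HasSum (fun n => F n t) (∑' n, F n t) ∧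
      ‖∑' n, F n t‖ ≤ ‖x₀‖ * Real.exp (M * |t - s|) ∧
      ∑' n, F n t = F 0 t + ∫ u in s..t, C u (∑' n, F n u) := by
    intro a ha
    have hsub : uIcc s a ⊆ J := hJ.uIcc_subset hs ha
    obtain ⟨M, hM⟩ := hC.bdd (min s a) (max s a)
    have hM0 : 0 ≤ M := (norm_nonneg _).trans (hM s ⟨hs, left_mem_uIcc⟩)
    refine ⟨M, ?_⟩
    have hsub' : ∀ t ∈ uIcc s a, uIoc s t ⊆ uIcc s a := fun t ht =>
      uIoc_subset_uIcc.trans (ordConnected_uIcc.uIcc_subset left_mem_uIcc ht)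
    -- `neumann_series` integrates against a measure, so the orientation of the interval integral is
    -- moved into the kernel as a sign.
    have e : ∀ (f : ℝ → X) (t : ℝ), ∫ u in s..t, C u (f u) =
        ∫ u in uIoc s t, (if s ≤ t then (1 : ℝ) else -1) • C u (f u) := by
      intro f t
      rw [intervalIntegral.intervalIntegral_eq_integral_uIoc, integral_smul]
    simp only [e]
    refine neumann_series (S := uIcc s a) (μ := fun t => volume.restrict (uIoc s t))
      (k := fun t u x => (if s ≤ t then (1 : ℝ) else -1) • C u x)
      (κ := fun _ _ => M) (v := fun t => ‖x₀‖ * Real.exp (M * |t - s|)) (F := F) ?_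
      (fun _ _ => hM0) (fun _ _ => by positivity) ?_ ?_ ?_ ?_ ?_ ?_ ?_
    · intro t ht
      filter_upwards [ae_restrict_mem measurableSet_uIoc] with u hu
      exact hsub' t ht hu
    · intro t _ u hu x
      have h1 : ‖(if s ≤ t then (1 : ℝ) else -1)‖ = 1 := by split_ifs <;> simp
      rw [norm_smul, h1, one_mul]
      exact (C u).le_of_opNorm_le (hM u ⟨hsub hu, hu⟩) x
    · intro t _ u _ f x hf
      exact ((C u).hasSum hf).const_smul _
    · intro n t _
      rw [hFs]
      exact e _ _
    · intro n t ht
      exact ((hC.clm_apply (.of_continuousOn hJc (hFc n))).aesm.mono_measure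
        (Measure.restrict_mono ((hsub' t ht).trans hsub) le_rfl)).const_smul _
    · intro n t ht
      exact ((LocallyBoundedOn.of_continuousOn hJc (hFc n)).aesm.mono_measure
        (Measure.restrict_mono ((hsub' t ht).trans hsub) le_rfl)).norm.const_mul _
    · intro t _
      have : Continuous fun u => M * (‖x₀‖ * Real.exp (M * |u - s|)) := by fun_prop
      exact intervalIntegrable_iff.1 (this.intervalIntegrable s t)
    · intro t _
      have : (fun u => M * (‖x₀‖ * Real.exp (M * |u - s|))) =
          fun u => ‖x₀‖ * (M * Real.exp (M * |u - s|)) := by ext; ring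
      rw [this, integral_const_mul, setIntegral_uIoc_mul_exp_abs, hF0]
      linarith
  set y : ℝ → X := fun t => ∑' n, F n t with hy
  have hyJ : ∀ t ∈ J, HasSum (fun n => F n t) (y t) := fun t ht => by
    obtain ⟨M, hM⟩ := main t ht
    exact (hM t right_mem_uIcc).1
  have hyeq : ∀ t ∈ J, y t = x₀ + ∫ u in s..t, C u (y u) := fun t ht => by
    obtain ⟨M, hM⟩ := main t ht
    exact (hM t right_mem_uIcc).2.2
  have hyb : LocallyBoundedOn y J := by
    refine ⟨aestronglyMeasurable_of_tendsto_ae atTop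
      (f := fun n u => ∑ i ∈ Finset.range n, F i u) (fun n => Finset.aestronglyMeasurable_fun_sum _
        fun i _ => (LocallyBoundedOn.of_continuousOn hJc (hFc i)).aesm) ?_, fun a b => ?_⟩
    · filter_upwards [ae_restrict_mem hJc.measurableSet] with u hu
      exact (hyJ u hu).tendsto_sum_nat
    · have hcpt : IsCompact (J ∩ Icc a b) := isCompact_Icc.inter_left hJc
      rcases (J ∩ Icc a b).eq_empty_or_nonempty with h | h
      · exact ⟨0, by simp [h]⟩
      obtain ⟨p, hp, hp'⟩ := hcpt.exists_isLeast h
      obtain ⟨q, hq, hq'⟩ := hcpt.exists_isGreatest h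
      obtain ⟨M, hM⟩ := main p hp.1
      obtain ⟨N, hN⟩ := main q hq.1
      obtain ⟨M', hM'⟩ := isCompact_Icc.exists_bound_of_continuousOn (s := Icc a b)
        (f := fun t => ‖x₀‖ * Real.exp (M * |t - s|)) (by fun_prop)
      obtain ⟨N', hN'⟩ := isCompact_Icc.exists_bound_of_continuousOn (s := Icc a b)
        (f := fun t => ‖x₀‖ * Real.exp (N * |t - s|)) (by fun_prop)
      refine ⟨max M' N', fun t ht => ?_⟩
      rcases le_total t s with h1 | h1
      · exact ((hM t (mem_uIcc.2 (.inr ⟨hp' ht, h1⟩))).2.1.trans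
          ((le_abs_self _).trans (hM' t ht.2))).trans (le_max_left _ _)
      · exact ((hN t (mem_uIcc.2 (.inl ⟨h1, hq' ht⟩))).2.1.trans
          ((le_abs_self _).trans (hN' t ht.2))).trans (le_max_right _ _)
  refine ⟨y, ?_, hyeq⟩
  exact (continuousOn_const.add ((hC.clm_apply hyb).integral_continuousOn hJ hs)).congr hyeq

/-! ### Evolution families and their adjoints -/

/-- The transition family of `x' = C(t) x` in a normed algebra. -/
structure IsEvolution {R : Type*} [NormedRing R] [NormedAlgebra ℝ R] (C : ℝ → R) (J : Set ℝ)
    (Φ : ℝ → ℝ → R) : Prop where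
  refl : ∀ s ∈ J, Φ s s = 1
  continuousOn : ∀ s ∈ J, ContinuousOn (fun t => Φ t s) J
  deriv_eq : ∀ s ∈ J, ∀ t ∈ J, ContinuousWithinAt C J t →
    HasDerivWithinAt (fun t => Φ t s) (C t * Φ t s) J t

section

variable {R : Type*} [NormedRing R] [NormedAlgebra ℝ R] [CompleteSpace R] {J : Set ℝ}
  {C : ℝ → R} {Φ : ℝ → ℝ → R}

theorem exists_isEvolution (hJc : IsClosed J) (hJ : J.OrdConnected) (hC : LocallyBoundedOn C J) :
    ∃ Φ : ℝ → ℝ → R, IsEvolution C J Φ := by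
  have h : ∀ s ∈ J, ∃ y : ℝ → R, ContinuousOn y J ∧
      ∀ t ∈ J, y t = 1 + ∫ u in s..t, C u * y u := fun s hs =>
    exists_volterra_solution hJc hJ (hC.clm_comp (ContinuousLinearMap.mul ℝ R)) 1 hs
  choose! y hyc hy using h
  refine ⟨fun t s => y s t, fun s hs => by simp [hy s hs s hs], hyc, fun s hs t ht hc => ?_⟩
  have h1 := ((hC.mul (.of_continuousOn hJc (hyc s hs))).integral_hasDerivWithinAt hJ hs ht
    (hc.mul (hyc s hs t ht))).const_add 1
  exact h1.congr (hy s hs) (hy s hs t ht)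

/-- The definition of Φ gives no regularity in its second argument. The adjoint equation is
therefore solved separately; its solution V(t,s) turns out to be Φ(s,t). -/
theorem exists_adjoint_evolution (hJc : IsClosed J) (hJ : J.OrdConnected)
    (hC : LocallyBoundedOn C J) :
    ∃ V : ℝ → ℝ → R, (∀ s ∈ J, V s s = 1) ∧ (∀ s ∈ J, ContinuousOn (fun t => V t s) J) ∧
      ∀ s ∈ J, ∀ t ∈ J, ContinuousWithinAt C J t →
        HasDerivWithinAt (fun t => V t s) (-(V t s * C t)) J t := by
  have h : ∀ s ∈ J, ∃ y : ℝ → R, ContinuousOn y J ∧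
      ∀ t ∈ J, y t = 1 + ∫ u in s..t, -(y u * C u) := fun s hs =>
    exists_volterra_solution hJc hJ (hC.clm_comp (-(ContinuousLinearMap.mul ℝ R).flip)) 1 hs
  choose! y hyc hy using h
  refine ⟨fun t s => y s t, fun s hs => by simp [hy s hs s hs], hyc, fun s hs t ht hc => ?_⟩
  have h1 := (((LocallyBoundedOn.of_continuousOn hJc (hyc s hs)).mul hC).neg
    |>.integral_hasDerivWithinAt hJ hs ht ((hyc s hs t ht).mul hc).neg).const_add 1
  exact h1.congr (hy s hs) (hy s hs t ht)

/-- The coefficient is locally bounded on `J` and has countably many discontinuities there. -/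
structure RegularCoeff (C : ℝ → R) (J : Set ℝ) : Prop where
  bdd : LocallyBoundedOn C J
  countable : {t ∈ J | ¬ContinuousWithinAt C J t}.Countable

namespace IsEvolution

/-- The derivatives -VC and CΦ cancel, so V(t,s)Φ(t,r) is constant in t and can be evaluated at t =
s. -/
theorem exists_adjoint (hΦ : IsEvolution C J Φ) (hJc : IsClosed J) (hJ : J.OrdConnected)
    (hC : RegularCoeff C J) :
    ∃ V : ℝ → ℝ → R, (∀ s ∈ J, ContinuousOn (fun t => V t s) J) ∧
      (∀ s ∈ J, ∀ t ∈ J, ContinuousWithinAt C J t →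
        HasDerivWithinAt (fun t => V t s) (-(V t s * C t)) J t) ∧
      ∀ s ∈ J, ∀ t ∈ J, ∀ r ∈ J, V t s * Φ t r = Φ s r := by
  obtain ⟨V, h1, h2, h3⟩ := exists_adjoint_evolution hJc hJ hC.bdd
  refine ⟨V, h2, h3, fun s hs t ht r hr => ?_⟩
  have := eq_of_hasDerivWithinAt_zero_off_countable hJ hC.countable
    (f := fun t => V t s * Φ t r) ((h2 s hs).mul (hΦ.continuousOn r hr)) (fun u hu => ?_) hs ht
  · simpa only [h1 s hs, one_mul] using this
  · have hc : ContinuousWithinAt C J u := by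
      by_contra hc
      exact hu.2 ⟨hu.1, hc⟩
    have := (h3 s hs u hu.1 hc).mul (hΦ.deriv_eq r hr u hu.1 hc)
    convert! this using 1
    noncomm_ring

theorem trans (hΦ : IsEvolution C J Φ) (hJc : IsClosed J) (hJ : J.OrdConnected)
    (hC : RegularCoeff C J) {t u s : ℝ} (ht : t ∈ J) (hu : u ∈ J) (hs : s ∈ J) :
    Φ t u * Φ u s = Φ t s := by
  obtain ⟨V, -, -, h⟩ := hΦ.exists_adjoint hJc hJ hC
  have h1 := h t ht u hu u hu
  rw [hΦ.refl u hu, mul_one] at h1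
  rw [← h1, h t ht u hu s hs]

theorem adjoint_properties (hΦ : IsEvolution C J Φ) (hJc : IsClosed J) (hJ : J.OrdConnected)
    (hC : RegularCoeff C J) :
    (∀ s ∈ J, ContinuousOn (fun t => Φ s t) J) ∧
      ∀ s ∈ J, ∀ t ∈ J, ContinuousWithinAt C J t →
        HasDerivWithinAt (fun t => Φ s t) (-(Φ s t * C t)) J t := by
  obtain ⟨V, h1, h2, h⟩ := hΦ.exists_adjoint hJc hJ hC
  have e : ∀ s ∈ J, ∀ t ∈ J, Φ s t = V t s := fun s hs t ht => by
    have := h s hs t ht t ht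
    rwa [hΦ.refl t ht, mul_one, eq_comm] at this
  refine ⟨fun s hs => (h1 s hs).congr (e s hs), fun s hs t ht hc => ?_⟩
  rw [e s hs t ht]
  exact (h2 s hs t ht hc).congr (e s hs) (e s hs t ht)

end IsEvolution

end

/-! ### Green's function of a dichotomy and its integral operator -/

/-- The data of an exponential dichotomy of an evolution family in a normed algebra. -/
structure IsDichotomy {R : Type*} [NormedRing R] (Φ : ℝ → ℝ → R) (J : Set ℝ) (P : ℝ → R)
    (K α : ℝ) : Prop where
  closed : IsClosed J
  ordConnected : J.OrdConnected
  refl : ∀ s ∈ J, Φ s s = 1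
  trans : ∀ t ∈ J, ∀ u ∈ J, ∀ s ∈ J, Φ t u * Φ u s = Φ t s
  contLeft : ∀ s ∈ J, ContinuousOn (fun t => Φ t s) J
  contRight : ∀ s ∈ J, ContinuousOn (fun t => Φ s t) J
  idem : ∀ t ∈ J, P t * P t = P t
  comm : ∀ s ∈ J, ∀ t ∈ J, Φ t s * P s = P t * Φ t s
  pos : 0 < α
  one_le : 1 ≤ K
  stable : ∀ s ∈ J, ∀ t ∈ J, s ≤ t → ‖Φ t s * P s‖ ≤ K * Real.exp (-α * (t - s))
  unstable : ∀ s ∈ J, ∀ t ∈ J, s ≤ t → ‖Φ s t * (1 - P t)‖ ≤ K * Real.exp (-α * (t - s))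

/-- Green's function of a dichotomy. -/
noncomputable def green {R : Type*} [NormedRing R] (Φ : ℝ → ℝ → R) (P : ℝ → R) (t u : ℝ) : R :=
  -- The stable branch is taken on the diagonal, so the value there is the projection itself.
  if t < u then -(Φ t u * (1 - P u)) else Φ t u * P u

open MeasureTheory in
/-- The integral operator on `J` whose kernel is Green's function. -/
noncomputable def greenOp {R : Type*} [NormedRing R] [NormedAlgebra ℝ R] (Φ : ℝ → ℝ → R)
    (P : ℝ → R) (J : Set ℝ) (f : ℝ → R) (t : ℝ) : R :=
  ∫ u in J, green Φ P t u * f u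

theorem green_eq {R : Type*} [NormedRing R] (Φ : ℝ → ℝ → R) (P : ℝ → R) (t u : ℝ) :
    green Φ P t u = Φ t u * (P u - if t < u then 1 else 0) := by
  unfold green
  split_ifs <;> noncomm_ring

namespace IsDichotomy

open MeasureTheory

variable {R : Type*} [NormedRing R] {J : Set ℝ}
  {Φ : ℝ → ℝ → R} {P : ℝ → R} {K α : ℝ}

section

variable (h : IsDichotomy Φ J P K α)
include h

/-- With the projection moved to the first argument, measurability in u follows from that of Φ(t,·);
no regularity of P is needed. -/
theorem green_eq' {t u : ℝ} (ht : t ∈ J) (hu : u ∈ J) :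
    green Φ P t u = (P t - if t < u then 1 else 0) * Φ t u := by
  rw [green_eq, mul_sub, sub_mul, h.comm u hu t ht]
  split_ifs <;> simp

theorem norm_green_le {t u : ℝ} (ht : t ∈ J) (hu : u ∈ J) :
    ‖green Φ P t u‖ ≤ K * Real.exp (-α * |t - u|) := by
  unfold green
  split_ifs with htu
  · rw [norm_neg, abs_of_nonpos (by linarith), neg_sub]
    exact h.unstable t ht u hu htu.le
  · rw [abs_of_nonneg (by linarith)]
    exact h.stable u hu t ht (not_lt.1 htu)

theorem locallyBoundedOn_green {s : ℝ} (hs : s ∈ J) :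
    LocallyBoundedOn (fun t => green Φ P t s) J := by
  have h1 : LocallyBoundedOn (fun t => Φ t s * P s - if t < s then Φ t s else 0) J :=
    .sub (.of_continuousOn h.closed ((h.contLeft s hs).mul continuousOn_const))
      (.ite measurableSet_Iio (.of_continuousOn h.closed (h.contLeft s hs)))
  have e : (fun t => green Φ P t s) =
      fun t => Φ t s * P s - if t < s then Φ t s else 0 := by
    ext t
    rw [green_eq, mul_sub]
    split_ifs <;> simp
  rwa [e]

theorem aesm_green {t : ℝ} (ht : t ∈ J) :
    AEStronglyMeasurable (fun u => green Φ P t u) (volume.restrict J) := by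
  have h1 : LocallyBoundedOn (fun u => P t * Φ t u - if t < u then Φ t u else 0) J :=
    .sub (.of_continuousOn h.closed (continuousOn_const.mul (h.contRight t ht)))
      (.ite measurableSet_Ioi (.of_continuousOn h.closed (h.contRight t ht)))
  refine h1.aesm.congr ?_
  filter_upwards [ae_restrict_mem h.closed.measurableSet] with u hu
  rw [h.green_eq' ht hu, sub_mul]
  split_ifs <;> simp

theorem integrable_green_mul {f : ℝ → R} {M t : ℝ} (hf : LocallyBoundedOn f J)
    (hM : ∀ u ∈ J, ‖f u‖ ≤ M) (ht : t ∈ J) :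
    IntegrableOn (fun u => green Φ P t u * f u) J := by
  have hi := (((integral_exp_neg_abs h.pos t).1.const_mul K).mul_const M).integrableOn (s := J)
  refine hi.mono' ((h.aesm_green ht).mul hf.aesm) ?_
  filter_upwards [ae_restrict_mem h.closed.measurableSet] with u hu
  refine (norm_mul_le _ _).trans (mul_le_mul (h.norm_green_le ht hu) (hM u hu) (norm_nonneg _) ?_)
  exact (norm_nonneg _).trans (h.norm_green_le ht hu)

variable [NormedAlgebra ℝ R]

theorem greenOp_sub {f g : ℝ → R} (hf : LocallyBoundedOn f J)
    (hfb : ∃ M, ∀ u ∈ J, ‖f u‖ ≤ M) (hg : LocallyBoundedOn g J) (hgb : ∃ M, ∀ u ∈ J, ‖g u‖ ≤ M)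
    {t : ℝ} (ht : t ∈ J) :
    greenOp Φ P J (fun u => f u - g u) t = greenOp Φ P J f t - greenOp Φ P J g t := by
  obtain ⟨M, hM⟩ := hfb
  obtain ⟨N, hN⟩ := hgb
  unfold greenOp
  rw [← integral_sub (h.integrable_green_mul hf hM ht) (h.integrable_green_mul hg hN ht)]
  simp only [mul_sub]

theorem norm_greenOp_le {f : ℝ → R} {t : ℝ} {w : ℝ → ℝ} (hw : ∀ u ∈ J, ‖f u‖ ≤ w u)
    (hi : IntegrableOn (fun u => Real.exp (-α * |t - u|) * w u) J) (ht : t ∈ J) :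
    ‖greenOp Φ P J f t‖ ≤ K * ∫ u in J, Real.exp (-α * |t - u|) * w u := by
  rw [← integral_const_mul]
  refine norm_integral_le_of_norm_le (hi.const_mul K) ?_
  filter_upwards [ae_restrict_mem h.closed.measurableSet] with u hu
  rw [← mul_assoc]
  refine (norm_mul_le _ _).trans (mul_le_mul (h.norm_green_le ht hu) (hw u hu) (norm_nonneg _) ?_)
  exact (norm_nonneg _).trans (h.norm_green_le ht hu)

theorem norm_greenOp_le_of_bound {f : ℝ → R} {M t : ℝ} (hM0 : 0 ≤ M) (hM : ∀ u ∈ J, ‖f u‖ ≤ M)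
    (ht : t ∈ J) : ‖greenOp Φ P J f t‖ ≤ K * (2 / α) * M := by
  have hi := integral_exp_neg_abs h.pos t
  have hK : 0 ≤ K := zero_le_one.trans h.one_le
  refine (h.norm_greenOp_le hM (hi.1.mul_const M).integrableOn ht).trans ?_
  rw [integral_mul_const, mul_assoc]
  gcongr
  rw [← hi.2]
  exact setIntegral_le_integral hi.1 (Eventually.of_forall fun u => (Real.exp_pos _).le)

theorem greenOp_mul_const {f : ℝ → R} {M t : ℝ} (hf : LocallyBoundedOn f J)
    (hM : ∀ u ∈ J, ‖f u‖ ≤ M) (c : R) (ht : t ∈ J) :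
    greenOp Φ P J (fun u => f u * c) t = greenOp Φ P J f t * c := by
  unfold greenOp
  rw [← integral_mul_const_of_integrable (h.integrable_green_mul hf hM ht)]
  simp only [mul_assoc]

/-- If f lives on u ≥ s, almost every contribution at s comes from the unstable branch, which P(s)
kills. The next lemma is the stable counterpart. -/
theorem proj_mul_greenOp {f : ℝ → R} {M s : ℝ} (hf : LocallyBoundedOn f J)
    (hM : ∀ u ∈ J, ‖f u‖ ≤ M) (hs : s ∈ J) (h0 : ∀ u ∈ J, u < s → f u = 0) :
    P s * greenOp Φ P J f s = 0 := by
  unfold greenOp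
  rw [← integral_const_mul_of_integrable (h.integrable_green_mul hf hM hs)]
  refine integral_eq_zero_of_ae ?_
  filter_upwards [ae_restrict_mem h.closed.measurableSet,
    ae_restrict_of_ae (Measure.ae_ne volume s)] with u hu hus
  rcases lt_or_gt_of_ne hus with h1 | h1
  · simp [h0 u hu h1]
  · rw [h.green_eq' hs hu, if_pos h1, ← mul_assoc, ← mul_assoc, mul_sub, h.idem s hs]
    simp

theorem one_sub_proj_mul_greenOp {f : ℝ → R} {M s : ℝ} (hf : LocallyBoundedOn f J)
    (hM : ∀ u ∈ J, ‖f u‖ ≤ M) (hs : s ∈ J) (h0 : ∀ u ∈ J, s ≤ u → f u = 0) :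
    (1 - P s) * greenOp Φ P J f s = 0 := by
  unfold greenOp
  rw [← integral_const_mul_of_integrable (h.integrable_green_mul hf hM hs)]
  refine integral_eq_zero_of_ae ?_
  filter_upwards [ae_restrict_mem h.closed.measurableSet] with u hu
  rcases le_or_gt s u with h1 | h1
  · simp [h0 u hu h1]
  · rw [h.green_eq' hs hu, if_neg (by linarith), ← mul_assoc, ← mul_assoc, sub_zero, sub_mul,
      h.idem s hs]
    simp

variable [CompleteSpace R]

/-- The inhomogeneous equation satisfied by `greenOp f`, as a variation of constants formula. -/
theorem mul_greenOp {f : ℝ → R} {M s t : ℝ} (hf : LocallyBoundedOn f J)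
    (hM : ∀ u ∈ J, ‖f u‖ ≤ M) (hs : s ∈ J) (ht : t ∈ J) :
    Φ s t * greenOp Φ P J f t = greenOp Φ P J f s + ∫ u in s..t, Φ s u * f u := by
  have key : ∀ s ∈ J, ∀ t ∈ J, s ≤ t →
      Φ s t * greenOp Φ P J f t = greenOp Φ P J f s + ∫ u in s..t, Φ s u * f u := by
    intro s hs t ht hst
    have hsub : Ioc s t ⊆ J := Ioc_subset_Icc_self.trans (h.ordConnected.out hs ht)
    rw [intervalIntegral.integral_of_le hst]
    have e : ∫ u in Ioc s t, Φ s u * f u =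
        ∫ u in J, (Ioc s t).indicator (fun u => Φ s u * f u) u := by
      rw [setIntegral_indicator measurableSet_Ioc, inter_eq_right.2 hsub]
    have hi := h.integrable_green_mul hf hM ht
    rw [e, ← sub_eq_iff_eq_add']
    unfold greenOp
    rw [← integral_const_mul_of_integrable hi,
      ← integral_sub (hi.const_mul _) (h.integrable_green_mul hf hM hs)]
    -- Transported to s, the kernels with poles u seen from t and from s differ only for s < u ≤ t,
    -- where the jump leaves exactly Φ(s,u).
    refine setIntegral_congr_fun h.closed.measurableSet fun u hu => ?_
    simp only [green_eq, ← mul_assoc, h.trans s hs t ht u hu]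
    by_cases h1 : s < u
    · by_cases h2 : t < u
      · rw [indicator_of_notMem (by simp [h2]), if_pos h1, if_pos h2, sub_self]
      · rw [indicator_of_mem (show u ∈ Ioc s t from ⟨h1, not_lt.1 h2⟩), if_pos h1, if_neg h2]
        noncomm_ring
    · have h2 : ¬ t < u := by linarith
      rw [indicator_of_notMem (by simp [h1]), if_neg h1, if_neg h2, sub_self]
  rcases le_total s t with hst | hst
  · exact key s hs t ht hst
  · have h1 := congrArg (Φ s t * ·) (key t ht s hs hst)
    simp only [mul_add, ← mul_assoc, h.trans s hs t ht s hs, h.refl s hs, one_mul] at h1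
    have hb : LocallyBoundedOn (fun u => Φ t u * f u) J :=
      (LocallyBoundedOn.of_continuousOn h.closed (h.contRight t ht)).mul hf
    have h2 := (ContinuousLinearMap.mul ℝ R (Φ s t)).intervalIntegral_comp_comm
      (hb.intervalIntegrable h.ordConnected ht hs)
    simp only [ContinuousLinearMap.mul_apply'] at h2
    rw [h1, ← h2, intervalIntegral.integral_symm t s]
    have e : ∫ u in t..s, Φ s t * (Φ t u * f u) = ∫ u in t..s, Φ s u * f u := by
      refine intervalIntegral.integral_congr fun u hu => ?_
      simp only [← mul_assoc, h.trans s hs t ht u (h.ordConnected.uIcc_subset ht hs hu)]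
    rw [e]
    abel

theorem continuousOn_greenOp {f : ℝ → R} {M : ℝ} (hf : LocallyBoundedOn f J)
    (hM : ∀ u ∈ J, ‖f u‖ ≤ M) : ContinuousOn (greenOp Φ P J f) J := by
  rcases J.eq_empty_or_nonempty with rfl | ⟨s, hs⟩
  · simp
  have hb : LocallyBoundedOn (fun u => Φ s u * f u) J :=
    (LocallyBoundedOn.of_continuousOn h.closed (h.contRight s hs)).mul hf
  refine ((h.contLeft s hs).mul (continuousOn_const.add
    (hb.integral_continuousOn h.ordConnected hs))).congr
      (f := fun t => Φ t s * (greenOp Φ P J f s + ∫ u in s..t, Φ s u * f u)) fun t ht => ?_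
  beta_reduce
  rw [← h.mul_greenOp hf hM hs ht, ← mul_assoc, h.trans t ht s hs t ht, h.refl t ht, one_mul]

end

end IsDichotomy

/-! ### The scalar majorant and the perturbed Green's function -/

-- The choice of r gives α²-(αr)² = 2αKδ, and the prefactor K/r makes the e^{-α|t-s|} term equal the
-- free term K e^{-α|t-s|}. Hence equality on the line; on J the integral of the nonnegative
-- integrand can only be smaller.
open MeasureTheory in
theorem exp_supersolution {K α δ r : ℝ} (hα : 0 < α) (hr : 0 < r)
    (hr2 : α * (1 - r ^ 2) = 2 * K * δ) (s t : ℝ) :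
    Integrable (fun u => Real.exp (-α * |t - u|) * (K / r * Real.exp (-(α * r) * |u - s|))) ∧
    K * δ * ∫ u, Real.exp (-α * |t - u|) * (K / r * Real.exp (-(α * r) * |u - s|)) =
      K / r * Real.exp (-(α * r) * |t - s|) - K * Real.exp (-α * |t - s|) := by
  obtain ⟨h1, h2⟩ := integral_exp_neg_abs_mul (a := α) (b := α * r) (by positivity) s t
  have e : (fun u => Real.exp (-α * |t - u|) * (K / r * Real.exp (-(α * r) * |u - s|))) =
      fun u => K / r * (Real.exp (-α * |t - u|) * Real.exp (-(α * r) * |u - s|)) := by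
    ext u; ring
  rw [e]
  refine ⟨h1.const_mul _, ?_⟩
  rw [integral_const_mul]
  set I := ∫ u, Real.exp (-α * |t - u|) * Real.exp (-(α * r) * |u - s|)
  have h3 : K * δ * I = Real.exp (-(α * r) * |t - s|) - r * Real.exp (-α * |t - s|) := by
    have h4 : (2 * α) * (K * δ * I) =
        (2 * α) * (Real.exp (-(α * r) * |t - s|) - r * Real.exp (-α * |t - s|)) := by
      linear_combination h2 - α * I * hr2
    exact mul_left_cancel₀ (by positivity) h4
  have h5 : K * δ * (K / r * I) = K / r * (K * δ * I) := by ring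
  rw [h5, h3]
  field_simp

namespace IsDichotomy

open MeasureTheory

variable {R : Type*} [NormedRing R] [NormedAlgebra ℝ R] [CompleteSpace R] {J : Set ℝ}
  {Φ : ℝ → ℝ → R} {P B : ℝ → R} {K α δ r : ℝ}

section

variable (h : IsDichotomy Φ J P K α) (hδ0 : 0 ≤ δ) (hBδ : ∀ t ∈ J, ‖B t‖ ≤ δ)
  (hr : 0 < r) (hr2 : α * (1 - r ^ 2) = 2 * K * δ)
include h hδ0 hBδ hr hr2

-- The free term is subtracted rather than discarded: on the diagonal this leaves K/r-K, which
-- controls Q-P.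
omit [CompleteSpace R] in
theorem norm_greenOp_mul_le {F : ℝ → R} {s t : ℝ} (ht : t ∈ J)
    (hF : ∀ u ∈ J, ‖F u‖ ≤ K / r * Real.exp (-(α * r) * |u - s|)) :
    ‖greenOp Φ P J (fun u => B u * F u) t‖ ≤
      K / r * Real.exp (-(α * r) * |t - s|) - K * Real.exp (-α * |t - s|) := by
  obtain ⟨h1, h2⟩ := exp_supersolution h.pos hr hr2 s t
  have hK : 0 ≤ K := zero_le_one.trans h.one_le
  have e : (fun u => Real.exp (-α * |t - u|) * (δ * (K / r * Real.exp (-(α * r) * |u - s|)))) =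
      fun u => δ * (Real.exp (-α * |t - u|) * (K / r * Real.exp (-(α * r) * |u - s|))) := by
    ext u; ring
  refine (h.norm_greenOp_le (w := fun u => δ * (K / r * Real.exp (-(α * r) * |u - s|)))
    (fun u hu => ?_) ?_ ht).trans ?_
  · exact (norm_mul_le _ _).trans (mul_le_mul (hBδ u hu) (hF u hu) (norm_nonneg _) hδ0)
  · rw [e]; exact (h1.const_mul δ).integrableOn
  · rw [e, integral_const_mul, ← mul_assoc, ← h2]
    exact mul_le_mul_of_nonneg_left (setIntegral_le_integral h1 (Eventually.of_forall fun u => by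
      simp only [Pi.zero_apply]; positivity)) (by positivity)

/-- Green's function of the perturbed equation, as the sum of the Neumann series. -/
theorem exists_perturbed_green (hB : LocallyBoundedOn B J) {s : ℝ} (hs : s ∈ J) :
    ∃ F : ℝ → R, LocallyBoundedOn F J ∧
      (∀ t ∈ J, ‖F t‖ ≤ K / r * Real.exp (-(α * r) * |t - s|)) ∧
      ∀ t ∈ J, F t = green Φ P t s + greenOp Φ P J (fun u => B u * F u) t := by
  have hK : 0 ≤ K := zero_le_one.trans h.one_le
  have hα := h.pos
  set F : ℕ → ℝ → R := fun n => Nat.rec (fun t => green Φ P t s)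
    (fun _ f => greenOp Φ P J (fun u => B u * f u)) n
  have hF0 : F 0 = fun t => green Φ P t s := rfl
  have hFs : ∀ n, F (n + 1) = greenOp Φ P J (fun u => B u * F n u) := fun n => rfl
  have hFb : ∀ n, LocallyBoundedOn (F n) J ∧ ∃ M, 0 ≤ M ∧ ∀ t ∈ J, ‖F n t‖ ≤ M := by
    intro n
    induction n with
    | zero =>
      refine ⟨h.locallyBoundedOn_green hs, K, hK, fun t ht => ?_⟩
      refine (h.norm_green_le ht hs).trans (mul_le_of_le_one_right hK ?_)
      rw [Real.exp_le_one_iff]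
      have := mul_nonneg hα.le (abs_nonneg (t - s))
      linarith
    | succ n ih =>
      obtain ⟨h1, M, hM0, hM⟩ := ih
      have hM' : ∀ u ∈ J, ‖B u * F n u‖ ≤ δ * M := fun u hu =>
        (norm_mul_le _ _).trans (mul_le_mul (hBδ u hu) (hM u hu) (norm_nonneg _) hδ0)
      rw [hFs]
      exact ⟨.of_continuousOn h.closed (h.continuousOn_greenOp (hB.mul h1) hM'),
        _, by positivity, fun t ht => h.norm_greenOp_le_of_bound (by positivity) hM' ht⟩
  have main := neumann_series (S := J) (μ := fun _ => volume.restrict J)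
    (k := fun t u x => green Φ P t u * (B u * x))
    (κ := fun t u => K * Real.exp (-α * |t - u|) * δ)
    (v := fun t => K / r * Real.exp (-(α * r) * |t - s|)) (F := F)
    (fun _ _ => ae_restrict_mem h.closed.measurableSet) (fun _ _ => by positivity)
    (fun _ _ => by positivity) ?_ ?_ ?_ ?_ ?_ ?_ ?_
  · set G : ℝ → R := fun t => ∑' n, F n t
    refine ⟨G, ⟨?_, fun a b => ?_⟩, fun t ht => (main t ht).2.1, fun t ht => (main t ht).2.2⟩
    · refine aestronglyMeasurable_of_tendsto_ae atTop
        (f := fun n u => ∑ i ∈ Finset.range n, F i u) (fun n =>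
          Finset.aestronglyMeasurable_fun_sum _ fun i _ => (hFb i).1.aesm) ?_
      filter_upwards [ae_restrict_mem h.closed.measurableSet] with u hu
      exact (main u hu).1.tendsto_sum_nat
    · refine ⟨K / r, fun t ht => (main t ht.1).2.1.trans ?_⟩
      refine mul_le_of_le_one_right (by positivity) ?_
      rw [Real.exp_le_one_iff]
      have := mul_nonneg (mul_pos hα hr).le (abs_nonneg (t - s))
      linarith
  · intro t ht u hu x
    rw [← mul_assoc]
    refine (norm_mul_le _ _).trans (mul_le_mul_of_nonneg_right ?_ (norm_nonneg _))
    exact (norm_mul_le _ _).trans (mul_le_mul (h.norm_green_le ht hu) (hBδ u hu) (norm_nonneg _)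
      (by positivity))
  · intro t _ u _ f x hf
    exact (hf.mul_left _).mul_left _
  · intro n t _
    rw [hFs]
    rfl
  · intro n t ht
    exact (h.aesm_green ht).mul (hB.aesm.mul (hFb n).1.aesm)
  · intro n t ht
    exact (Continuous.aestronglyMeasurable (by fun_prop)).mul (hFb n).1.aesm.norm
  · intro t _
    have e : (fun u => K * Real.exp (-α * |t - u|) * δ *
        (K / r * Real.exp (-(α * r) * |u - s|))) = fun u => K * δ *
          (Real.exp (-α * |t - u|) * (K / r * Real.exp (-(α * r) * |u - s|))) := by
      ext u; ring
    rw [e]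
    exact ((exp_supersolution hα hr hr2 s t).1.const_mul _).integrableOn
  · intro t ht
    obtain ⟨h1, h2⟩ := exp_supersolution hα hr hr2 s t
    have e : (fun u => K * Real.exp (-α * |t - u|) * δ *
        (K / r * Real.exp (-(α * r) * |u - s|))) = fun u => K * δ *
          (Real.exp (-α * |t - u|) * (K / r * Real.exp (-(α * r) * |u - s|))) := by
      ext u; ring
    rw [e, integral_const_mul]
    have h3 := h.norm_green_le ht hs
    have h4 : ∫ u in J, Real.exp (-α * |t - u|) * (K / r * Real.exp (-(α * r) * |u - s|)) ≤
        ∫ u, Real.exp (-α * |t - u|) * (K / r * Real.exp (-(α * r) * |u - s|)) :=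
      setIntegral_le_integral h1 (Eventually.of_forall fun u => by
        simp only [Pi.zero_apply]; positivity)
    have h5 := mul_le_mul_of_nonneg_left h4 (mul_nonneg hK hδ0)
    rw [hF0]
    linarith

end

omit [CompleteSpace R] in
/-- A bounded solution of the homogeneous equation `f = T(Bf)` vanishes. -/
theorem eq_zero_of_greenOp_eq (h : IsDichotomy Φ J P K α) (hδ0 : 0 ≤ δ)
    (hBδ : ∀ t ∈ J, ‖B t‖ ≤ δ) (hlt : K * (2 / α) * δ < 1) {f : ℝ → R} {M : ℝ}
    (hM : ∀ t ∈ J, ‖f t‖ ≤ M) (hf : ∀ t ∈ J, f t = greenOp Φ P J (fun u => B u * f u) t) :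
    ∀ t ∈ J, f t = 0 := by
  have hα := h.pos
  have hK : 0 ≤ K := zero_le_one.trans h.one_le
  intro t ht
  refine norm_le_zero_iff.1 (nonpos_of_bound_improves (g := fun t => ‖f t‖)
    (by positivity) hlt hM (fun N hN0 hN t ht => ?_) t ht)
  rw [hf t ht, mul_assoc]
  exact h.norm_greenOp_le_of_bound (by positivity) (fun u hu => (norm_mul_le _ _).trans
    (mul_le_mul (hBδ u hu) (hN u hu) (norm_nonneg _) hδ0)) ht

end IsDichotomy

/-! ### The perturbed evolution and the algebra of the new projections -/

/-- `Ψ` is the evolution family obtained from `Φ` by adding `B` to the coefficient, expressed by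
variation of constants. -/
structure IsPerturbation {R : Type*} [NormedRing R] [NormedAlgebra ℝ R] (Φ Ψ : ℝ → ℝ → R)
    (B : ℝ → R) (J : Set ℝ) : Prop where
  refl : ∀ s ∈ J, Ψ s s = 1
  trans : ∀ t ∈ J, ∀ u ∈ J, ∀ s ∈ J, Ψ t u * Ψ u s = Ψ t s
  contLeft : ∀ s ∈ J, ContinuousOn (fun t => Ψ t s) J
  bdd : LocallyBoundedOn B J
  voc : ∀ s ∈ J, ∀ t ∈ J, Φ s t * Ψ t s = 1 + ∫ u in s..t, Φ s u * (B u * Ψ u s)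
  eq_zero : ∀ s ∈ J, ∀ f : ℝ → R, LocallyBoundedOn f J →
    (∀ t ∈ J, Φ s t * f t = ∫ u in s..t, Φ s u * (B u * f u)) → ∀ t ∈ J, f t = 0

section

variable {R : Type*} [NormedRing R] {J : Set ℝ}

theorem exists_bound_mul {f g : ℝ → R} (hf : ∃ M, ∀ t ∈ J, ‖f t‖ ≤ M)
    (hg : ∃ M, ∀ t ∈ J, ‖g t‖ ≤ M) : ∃ M, ∀ t ∈ J, ‖f t * g t‖ ≤ M := by
  obtain ⟨M, hM⟩ := hf
  obtain ⟨N, hN⟩ := hg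
  exact ⟨M * N, fun t ht => (norm_mul_le _ _).trans
    (mul_le_mul (hM t ht) (hN t ht) (norm_nonneg _) ((norm_nonneg _).trans (hM t ht)))⟩

theorem exists_bound_sub {f g : ℝ → R} (hf : ∃ M, ∀ t ∈ J, ‖f t‖ ≤ M)
    (hg : ∃ M, ∀ t ∈ J, ‖g t‖ ≤ M) : ∃ M, ∀ t ∈ J, ‖f t - g t‖ ≤ M := by
  obtain ⟨M, hM⟩ := hf
  obtain ⟨N, hN⟩ := hg
  exact ⟨M + N, fun t ht => (norm_sub_le _ _).trans (add_le_add (hM t ht) (hN t ht))⟩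

theorem exists_bound_ite {p : ℝ → Prop} [DecidablePred p] {f : ℝ → R}
    (hf : ∃ M, ∀ t ∈ J, ‖f t‖ ≤ M) : ∃ M, ∀ t ∈ J, ‖if p t then f t else 0‖ ≤ M := by
  obtain ⟨M, hM⟩ := hf
  refine ⟨M, fun t ht => ?_⟩
  have h := hM t ht
  split_ifs
  · exact h
  · simpa using (norm_nonneg _).trans h

end

section

variable {R : Type*} [NormedRing R] [NormedAlgebra ℝ R] [CompleteSpace R] {J : Set ℝ}
  {A B P : ℝ → R} {Φ Ψ : ℝ → ℝ → R} {K α δ r : ℝ}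

theorem IsEvolution.isPerturbation (hΦ : IsEvolution A J Φ)
    (hΨ : IsEvolution (fun t => A t + B t) J Ψ) (hJc : IsClosed J) (hJ : J.OrdConnected)
    (hA : RegularCoeff A J) (hB : RegularCoeff B J) : IsPerturbation Φ Ψ B J := by
  set D := {t ∈ J | ¬ContinuousWithinAt A J t} ∪ {t ∈ J | ¬ContinuousWithinAt B J t}
  have hD : D.Countable := hA.countable.union hB.countable
  have hDA : ∀ t ∈ J \ D, ContinuousWithinAt A J t := fun t ht => by
    by_contra hc
    exact ht.2 (.inl ⟨ht.1, hc⟩)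
  have hDB : ∀ t ∈ J \ D, ContinuousWithinAt B J t := fun t ht => by
    by_contra hc
    exact ht.2 (.inr ⟨ht.1, hc⟩)
  have hAB : RegularCoeff (fun t => A t + B t) J := by
    refine ⟨hA.bdd.add hB.bdd, hD.mono fun t ht => ?_⟩
    by_contra hc
    exact ht.2 ((hDA t ⟨ht.1, hc⟩).add (hDB t ⟨ht.1, hc⟩))
  obtain ⟨hΦc, hΦd⟩ := hΦ.adjoint_properties hJc hJ hA
  obtain ⟨hΨc, hΨd⟩ := hΨ.adjoint_properties hJc hJ hAB
  refine ⟨hΨ.refl, fun t ht u hu s hs => hΨ.trans hJc hJ hAB ht hu hs, hΨ.continuousOn, hB.bdd,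
    fun s hs t ht => ?_, fun s hs f hf hf' t ht => ?_⟩
  · have := integral_eq_sub_of_hasDerivWithinAt_off_countable hJ hD
      (f := fun u => Φ s u * Ψ u s) (f' := fun u => Φ s u * (B u * Ψ u s))
      ((hΦc s hs).mul (hΨ.continuousOn s hs))
      ((LocallyBoundedOn.of_continuousOn hJc (hΦc s hs)).mul
        (hB.bdd.mul (.of_continuousOn hJc (hΨ.continuousOn s hs)))) (fun u hu => ?_) hs ht
    · rw [this, hΦ.refl s hs, hΨ.refl s hs]
      noncomm_ring
    · convert! (hΦd s hs u hu.1 (hDA u hu)).mul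
        (hΨ.deriv_eq s hs u hu.1 ((hDA u hu).add (hDB u hu))) using 1
      noncomm_ring
  · set e : ℝ → R := fun t => ∫ u in s..t, Φ s u * (B u * f u)
    have hint : LocallyBoundedOn (fun u => Φ s u * (B u * f u)) J :=
      (LocallyBoundedOn.of_continuousOn hJc (hΦc s hs)).mul (hB.bdd.mul hf)
    have hfe : ∀ t ∈ J, f t = Φ t s * e t := fun t ht => by
      change f t = Φ t s * ∫ u in s..t, Φ s u * (B u * f u)
      rw [← hf' t ht, ← mul_assoc, hΦ.trans hJc hJ hA ht hs ht, hΦ.refl t ht, one_mul]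
    have hec : ContinuousOn e J := hint.integral_continuousOn hJ hs
    have hfc : ContinuousOn f J := ((hΦ.continuousOn s hs).mul hec).congr hfe
    have hfs : f s = 0 := by
      rw [hfe s hs]
      simp [e]
    have := eq_of_hasDerivWithinAt_zero_off_countable hJ hD (f := fun u => Ψ s u * f u)
      ((hΨc s hs).mul hfc) (fun u hu => ?_) hs ht
    · simp only [hfs, mul_zero] at this
      have h2 := congrArg (Ψ t s * ·) this
      simpa only [← mul_assoc, hΨ.trans hJc hJ hAB ht hs ht, hΨ.refl t ht, one_mul, mul_zero]
        using h2
    · have h1 : HasDerivWithinAt e (Φ s u * (B u * f u)) J u :=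
        hint.integral_hasDerivWithinAt hJ hs hu.1
          ((hΦc s hs u hu.1).mul ((hDB u hu).mul (hfc u hu.1)))
      have h2 := ((hΦ.deriv_eq s hs u hu.1 (hDA u hu)).mul h1).congr hfe (hfe u hu.1)
      have h3 : A u * Φ u s * e u + Φ u s * (Φ s u * (B u * f u)) = A u * f u + B u * f u := by
        rw [mul_assoc, ← hfe u hu.1, ← mul_assoc (Φ u s), hΦ.trans hJc hJ hA hu.1 hs hu.1,
          hΦ.refl u hu.1, one_mul]
      rw [h3] at h2
      convert! (hΨd s hs u hu.1 ((hDA u hu).add (hDB u hu))).mul h2 using 1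
      noncomm_ring

/-- `F` is a bounded solution of the integral equation for Green's function with pole `s` of the
perturbed equation. -/
structure IsPerturbedGreen (Φ : ℝ → ℝ → R) (P B : ℝ → R) (J : Set ℝ) (s : ℝ) (F : ℝ → R) :
    Prop where
  bdd : LocallyBoundedOn F J
  bound : ∃ M, ∀ t ∈ J, ‖F t‖ ≤ M
  eq : ∀ t ∈ J, F t = green Φ P t s + greenOp Φ P J (fun u => B u * F u) t

namespace IsDichotomy

open MeasureTheory

variable (h : IsDichotomy Φ J P K α)
include h

omit [NormedAlgebra ℝ R] [CompleteSpace R] in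
theorem mul_green_self {s t : ℝ} (hs : s ∈ J) (ht : t ∈ J) :
    Φ s t * green Φ P t s = P s - if t < s then 1 else 0 := by
  rw [green_eq, ← mul_assoc, h.trans s hs t ht s hs, h.refl s hs, one_mul]

omit [NormedAlgebra ℝ R] [CompleteSpace R] in
theorem green_self {s : ℝ} (hs : s ∈ J) : green Φ P s s = P s := by
  simp [green_eq, h.refl s hs]

omit [NormedAlgebra ℝ R] [CompleteSpace R] in
theorem mul_left_cancel {s t : ℝ} (hs : s ∈ J) (ht : t ∈ J) {x y : R}
    (hxy : Φ s t * x = Φ s t * y) : x = y := by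
  have := congrArg (Φ t s * ·) hxy
  simpa only [← mul_assoc, h.trans t ht s hs t ht, h.refl t ht, one_mul] using this

variable (hΨ : IsPerturbation Φ Ψ B J) (hBb : ∃ M, ∀ t ∈ J, ‖B t‖ ≤ M)
include hΨ hBb

theorem mul_perturbedGreen {F : ℝ → R} {s t : ℝ} (hF : IsPerturbedGreen Φ P B J s F)
    (hs : s ∈ J) (ht : t ∈ J) :
    Φ s t * F t = F s - (if t < s then 1 else 0) + ∫ u in s..t, Φ s u * (B u * F u) := by
  obtain ⟨M, hM⟩ := exists_bound_mul hBb hF.bound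
  rw [hF.eq t ht, mul_add, h.mul_green_self hs ht, h.mul_greenOp (hΨ.bdd.mul hF.bdd) hM hs ht]
  rw [hF.eq s hs, h.green_self hs]
  abel

/-- Green's function of the perturbed equation in terms of its evolution family. -/
theorem perturbedGreen_eq {F : ℝ → R} {s t : ℝ} (hF : IsPerturbedGreen Φ P B J s F)
    (hs : s ∈ J) (ht : t ∈ J) : F t = Ψ t s * (F s - if t < s then 1 else 0) := by
  have hΨb : LocallyBoundedOn (fun t => Ψ t s) J := .of_continuousOn h.closed (hΨ.contLeft s hs)
  have hΦb : LocallyBoundedOn (fun t => Φ s t) J := .of_continuousOn h.closed (h.contRight s hs)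
  -- The difference of the two sides satisfies the homogeneous Volterra equation, to which `eq_zero`
  -- applies.
  have hf : LocallyBoundedOn (fun t => F t - Ψ t s * (F s - if t < s then 1 else 0)) J := by
    refine hF.bdd.sub ?_
    have h1 : LocallyBoundedOn (fun t => Ψ t s * F s - if t < s then Ψ t s else 0) J :=
      (hΨb.mul (.of_continuousOn h.closed continuousOn_const)).sub (.ite measurableSet_Iio hΨb)
    have e : (fun t => Ψ t s * (F s - if t < s then 1 else 0)) =
        fun t => Ψ t s * F s - if t < s then Ψ t s else 0 := by
      ext t
      rw [mul_sub]
      split_ifs <;> simp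
    rwa [e]
  refine sub_eq_zero.1 (hΨ.eq_zero s hs _ hf (fun t ht => ?_) t ht)
  have i1 : IntervalIntegrable (fun u => Φ s u * (B u * F u)) volume s t :=
    (hΦb.mul (hΨ.bdd.mul hF.bdd)).intervalIntegrable h.ordConnected hs ht
  have i2 : IntervalIntegrable (fun u => Φ s u * (B u * Ψ u s)) volume s t :=
    (hΦb.mul (hΨ.bdd.mul hΨb)).intervalIntegrable h.ordConnected hs ht
  set c : R := F s - if t < s then 1 else 0 with hc
  have e1 : ∫ u in s..t, Φ s u * (B u * (F u - Ψ u s * (F s - if u < s then 1 else 0))) =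
      ∫ u in s..t, (Φ s u * (B u * F u) - Φ s u * (B u * Ψ u s) * c) := by
    refine intervalIntegral.integral_congr_ae ?_
    filter_upwards [Measure.ae_ne volume s] with u hus hu
    have : (if u < s then (1 : R) else 0) = if t < s then 1 else 0 := by
      rcases le_total s t with hst | hst
      · rw [uIoc_of_le hst] at hu
        rw [if_neg (not_lt.2 hu.1.le), if_neg (not_lt.2 hst)]
      · rw [uIoc_of_ge hst] at hu
        have h1 := lt_of_le_of_ne hu.2 hus
        rw [if_pos h1, if_pos (hu.1.trans h1)]
    rw [this, ← hc]
    noncomm_ring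
  have e2 := ((ContinuousLinearMap.mul ℝ R).flip c).intervalIntegral_comp_comm i2
  simp only [ContinuousLinearMap.flip_apply, ContinuousLinearMap.mul_apply'] at e2
  have i3 : IntervalIntegrable (fun u => Φ s u * (B u * Ψ u s) * c) volume s t :=
    ((hΦb.mul (hΨ.bdd.mul hΨb)).mul (.of_continuousOn h.closed
      (continuousOn_const (c := c)))).intervalIntegrable h.ordConnected hs ht
  rw [e1, intervalIntegral.integral_sub i1 i3, e2, mul_sub,
    h.mul_perturbedGreen hΨ hBb hF hs ht, ← mul_assoc, hΨ.voc s hs t ht, ← hc]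
  noncomm_ring

variable (huniq : ∀ f : ℝ → R, (∃ M, ∀ t ∈ J, ‖f t‖ ≤ M) →
  (∀ t ∈ J, f t = greenOp Φ P J (fun u => B u * f u) t) → ∀ t ∈ J, f t = 0)
include huniq

/-- Both t ↦ F(t)F(s) and the truncation W of F to t ≥ s are bounded solutions of the integral
equation with free term G(·,s)F(s). They coincide by uniqueness; evaluate at s. -/
theorem perturbedGreen_idem {F : ℝ → R} {s : ℝ} (hF : IsPerturbedGreen Φ P B J s F)
    (hs : s ∈ J) : F s * F s = F s := by
  set W : ℝ → R := fun t => if s ≤ t then F t else 0 with hW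
  have hWl : LocallyBoundedOn W J := hF.bdd.ite measurableSet_Ici
  have hWb : ∃ M, ∀ t ∈ J, ‖W t‖ ≤ M := exists_bound_ite hF.bound
  obtain ⟨M, hM⟩ := exists_bound_mul hBb hWb
  obtain ⟨N, hN⟩ := exists_bound_mul hBb (exists_bound_sub hF.bound hWb)
  have hBF := exists_bound_mul hBb hF.bound
  have hFW : LocallyBoundedOn (fun u => F u - W u) J := hF.bdd.sub hWl
  -- The P-component vanishes since W lives on t ≥ s; the complementary one is read off from F,
  -- since F - W lives on t < s.
  have hNs : greenOp Φ P J (fun u => B u * W u) s = (1 - P s) * F s := by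
    have h1 := h.proj_mul_greenOp (hΨ.bdd.mul hWl) hM hs fun u _ hus => by
      simp [hW, not_le.2 hus]
    have h2 := h.one_sub_proj_mul_greenOp (hΨ.bdd.mul hFW) hN hs fun u _ hus => by
      simp [hW, hus]
    have h3 : (fun u => B u * (F u - W u)) = fun u => B u * F u - B u * W u := by
      ext u; rw [mul_sub]
    rw [h3, h.greenOp_sub (hΨ.bdd.mul hF.bdd) hBF (hΨ.bdd.mul hWl) ⟨M, hM⟩ hs] at h2
    have h4 := hF.eq s hs
    rw [h.green_self hs] at h4
    have h5 : greenOp Φ P J (fun u => B u * F u) s = F s - P s := by rw [h4]; abel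
    rw [h5] at h2
    have h6 := h.idem s hs
    have h7 : (1 - P s) * F s - greenOp Φ P J (fun u => B u * W u) s =
        (1 - P s) * (F s - P s - greenOp Φ P J (fun u => B u * W u) s) + (P s - P s * P s)
          - P s * greenOp Φ P J (fun u => B u * W u) s := by noncomm_ring
    rw [h2, h6, h1] at h7
    simp only [sub_self, add_zero] at h7
    exact (sub_eq_zero.1 h7).symm
  have hWeq : ∀ t ∈ J, W t = green Φ P t s * F s + greenOp Φ P J (fun u => B u * W u) t := by
    intro t ht
    refine h.mul_left_cancel hs ht ?_
    rw [mul_add, ← mul_assoc, h.mul_green_self hs ht, h.mul_greenOp (hΨ.bdd.mul hWl) hM hs ht, hNs]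
    by_cases hst : s ≤ t
    · have e : ∫ u in s..t, Φ s u * (B u * W u) = ∫ u in s..t, Φ s u * (B u * F u) := by
        refine intervalIntegral.integral_congr fun u hu => ?_
        rw [uIcc_of_le hst] at hu
        simp [hW, hu.1]
      have e2 : W t = F t := by simp [hW, hst]
      rw [e, e2, h.mul_perturbedGreen hΨ hBb hF hs ht, if_neg (not_lt.2 hst)]
      noncomm_ring
    · have e : ∫ u in s..t, Φ s u * (B u * W u) = 0 := by
        refine intervalIntegral.integral_zero_ae ?_
        filter_upwards [Measure.ae_ne volume s] with u hus hu
        rw [uIoc_of_ge (not_le.1 hst).le] at hu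
        simp [hW, lt_of_le_of_ne hu.2 hus]
      have e2 : W t = 0 := by simp [hW, hst]
      rw [e, e2, if_pos (not_le.1 hst)]
      noncomm_ring
  have hFc : ∃ M, ∀ t ∈ J, ‖F t * F s‖ ≤ M := exists_bound_mul hF.bound ⟨‖F s‖, fun _ _ => le_rfl⟩
  have hFcl : LocallyBoundedOn (fun t => F t * F s) J :=
    hF.bdd.mul (.of_continuousOn h.closed continuousOn_const)
  have := huniq (fun t => F t * F s - W t) (exists_bound_sub hFc hWb) (fun t ht => ?_) s hs
  · have e2 : W s = F s := by simp [hW]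
    rw [e2] at this
    exact sub_eq_zero.1 this
  · obtain ⟨M', hM'⟩ := hBF
    have e3 : (fun u => B u * (F u * F s - W u)) = fun u => B u * F u * F s - B u * W u := by
      ext u; noncomm_ring
    have e4 : (fun u => B u * F u * F s) = fun u => B u * (F u * F s) := by
      ext u; noncomm_ring
    rw [e3, h.greenOp_sub (e4 ▸ hΨ.bdd.mul hFcl) (by simpa only [mul_assoc] using exists_bound_mul hBb hFc)
      (hΨ.bdd.mul hWl) ⟨M, hM⟩ ht, h.greenOp_mul_const (hΨ.bdd.mul hF.bdd) hM' _ ht,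
      hWeq t ht]
    nth_rewrite 1 [hF.eq t ht]
    noncomm_ring

/-- The difference F - GΨ(τ,s) must be the piece V of the orbit Ψ(·,s) over [s,τ): V solves the
equation whose free term is the difference of the two free terms. Uniqueness at τ, where V vanishes
because the interval is half-open, gives F(τ) = G(τ)Ψ(τ,s). -/
theorem perturbedGreen_comm {F G : ℝ → R} {s τ : ℝ} (hF : IsPerturbedGreen Φ P B J s F)
    (hG : IsPerturbedGreen Φ P B J τ G) (hs : s ∈ J) (hτ : τ ∈ J) (hsτ : s ≤ τ) :
    G τ * Ψ τ s = Ψ τ s * F s := by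
  have hΨb : LocallyBoundedOn (fun t => Ψ t s) J := .of_continuousOn h.closed (hΨ.contLeft s hs)
  have hΦb : LocallyBoundedOn (fun t => Φ s t) J := .of_continuousOn h.closed (h.contRight s hs)
  set V : ℝ → R := fun t => if t ∈ Ico s τ then Ψ t s else 0 with hV
  have hVl : LocallyBoundedOn V J := hΨb.ite measurableSet_Ico
  have hVb : ∃ M, ∀ t ∈ J, ‖V t‖ ≤ M := by
    obtain ⟨M, hM⟩ := hΨb.bdd s τ
    have hM0 : 0 ≤ M := (norm_nonneg _).trans (hM s ⟨hs, left_mem_Icc.2 hsτ⟩)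
    refine ⟨M, fun t ht => ?_⟩
    simp only [hV]
    split_ifs with h1
    · exact hM t ⟨ht, Ico_subset_Icc_self h1⟩
    · simpa using hM0
  obtain ⟨M, hM⟩ := exists_bound_mul hBb hVb
  have hBV := hΨ.bdd.mul hVl
  set I : ℝ → R := fun t => ∫ u in s..t, Φ s u * (B u * Ψ u s) with hI
  set g : ℝ → R := greenOp Φ P J (fun u => B u * V u) with hg
  have j1 : ∀ t ∈ J, s ≤ t → t ≤ τ → ∫ u in s..t, Φ s u * (B u * V u) = I t := by
    intro t ht hst htτ
    refine intervalIntegral.integral_congr_ae ?_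
    filter_upwards [Measure.ae_ne volume τ] with u huτ hu
    rw [uIoc_of_le hst] at hu
    simp [hV, hu.1.le, lt_of_le_of_ne (hu.2.trans htτ) huτ]
  -- The two support lemmas give P(s)g(s) = 0 and (1-P(τ))g(τ) = 0; transporting the second back to
  -- s determines g(s).
  have hgs : g s = -(1 - P s) * I τ := by
    have h1 : P s * g s = 0 := h.proj_mul_greenOp hBV hM hs fun u _ hu => by
      simp [hV, not_le.2 hu]
    have h2 : (1 - P τ) * g τ = 0 := h.one_sub_proj_mul_greenOp hBV hM hτ fun u _ hu => by
      simp [hV, not_lt.2 hu]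
    have h3 := h.mul_greenOp hBV hM hs hτ
    rw [j1 τ hτ hsτ le_rfl] at h3
    have h4 : (1 - P s) * (Φ s τ * g τ) = 0 := by
      have : (1 - P s) * (Φ s τ * g τ) = Φ s τ * ((1 - P τ) * g τ) := by
        rw [← mul_assoc, sub_mul, ← h.comm τ hτ s hs]
        noncomm_ring
      rw [this, h2, mul_zero]
    rw [hg, h3, ← hg] at h4
    have h5 : g s = (1 - P s) * (g s + I τ) + P s * g s - (1 - P s) * I τ := by noncomm_ring
    rw [h4, h1] at h5
    rw [h5]
    noncomm_ring
  have hVeq : ∀ t ∈ J, V t = green Φ P t s + g t - green Φ P t τ * Ψ τ s := by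
    intro t ht
    refine h.mul_left_cancel hs ht ?_
    have k1 : Φ s t * (green Φ P t τ * Ψ τ s) = (P s - if t < τ then 1 else 0) * (1 + I τ) := by
      rw [← hΨ.voc s hs τ hτ, h.green_eq' ht hτ, ← mul_assoc, ← mul_assoc, mul_sub,
        h.comm t ht s hs, ← mul_assoc]
      have : Φ s t * (if t < τ then (1 : R) else 0) = (if t < τ then 1 else 0) * Φ s t := by
        split_ifs <;> simp
      rw [this, ← sub_mul, mul_assoc _ (Φ s t), h.trans s hs t ht τ hτ]
    rw [mul_sub, mul_add, h.mul_green_self hs ht, k1, h.mul_greenOp hBV hM hs ht, ← hg, hgs]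
    rcases lt_or_ge t s with hts | hst
    · have e : ∫ u in s..t, Φ s u * (B u * V u) = 0 := by
        refine intervalIntegral.integral_zero_ae ?_
        filter_upwards [Measure.ae_ne volume s] with u hus hu
        rw [uIoc_of_ge hts.le] at hu
        simp [hV, lt_of_le_of_ne hu.2 hus]
      have e2 : V t = 0 := by simp [hV, not_le.2 hts]
      rw [e, e2, if_pos hts, if_pos (hts.trans_le hsτ)]
      noncomm_ring
    · rcases lt_or_ge t τ with htτ | hτt
      · have e2 : V t = Ψ t s := by simp [hV, hst, htτ]
        rw [j1 t ht hst htτ.le, e2, if_neg (not_lt.2 hst), if_pos htτ, hΨ.voc s hs t ht]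
        noncomm_ring
      · have e : ∫ u in s..t, Φ s u * (B u * V u) = I τ := by
          have hl := hΦb.mul hBV
          rw [← intervalIntegral.integral_add_adjacent_intervals
            (hl.intervalIntegrable h.ordConnected hs hτ)
            (hl.intervalIntegrable h.ordConnected hτ ht), j1 τ hτ hsτ le_rfl]
          convert add_zero _
          refine intervalIntegral.integral_zero_ae (Eventually.of_forall fun u hu => ?_)
          rw [uIoc_of_le hτt] at hu
          simp [hV, not_lt.2 hu.1.le]
        have e2 : V t = 0 := by simp [hV, not_lt.2 hτt]
        rw [e, e2, if_neg (not_lt.2 hst), if_neg (not_lt.2 hτt)]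
        noncomm_ring
  have hGc : ∃ M, ∀ t ∈ J, ‖G t * Ψ τ s‖ ≤ M :=
    exists_bound_mul hG.bound ⟨‖Ψ τ s‖, fun _ _ => le_rfl⟩
  have hGcl : LocallyBoundedOn (fun t => G t * Ψ τ s) J :=
    hG.bdd.mul (.of_continuousOn h.closed continuousOn_const)
  have := huniq (fun t => F t - V t - G t * Ψ τ s)
    (exists_bound_sub (exists_bound_sub hF.bound hVb) hGc) (fun t ht => ?_) τ hτ
  · have e2 : V τ = 0 := by simp [hV]
    rw [e2, sub_zero] at this
    rw [← sub_eq_zero.1 this, h.perturbedGreen_eq hΨ hBb hF hs hτ, if_neg (not_lt.2 hsτ), sub_zero]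
  · obtain ⟨N, hN⟩ := exists_bound_mul hBb hG.bound
    have e3 : (fun u => B u * (F u - V u - G u * Ψ τ s)) =
        fun u => (B u * F u - B u * V u) - B u * G u * Ψ τ s := by
      ext u; noncomm_ring
    have e4 : (fun u => B u * G u * Ψ τ s) = fun u => B u * (G u * Ψ τ s) := by
      ext u; noncomm_ring
    have hBF := exists_bound_mul hBb hF.bound
    rw [e3, h.greenOp_sub ((hΨ.bdd.mul hF.bdd).sub hBV) (exists_bound_sub hBF ⟨M, hM⟩)
      (e4 ▸ hΨ.bdd.mul hGcl) (by simpa only [mul_assoc] using exists_bound_mul hBb hGc) ht,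
      h.greenOp_sub (hΨ.bdd.mul hF.bdd) hBF hBV ⟨M, hM⟩ ht,
      h.greenOp_mul_const (hΨ.bdd.mul hG.bdd) hN _ ht, hVeq t ht, hF.eq t ht]
    nth_rewrite 1 [hG.eq t ht]
    noncomm_ring

end IsDichotomy

end

/-! ### Equality of ranks -/

theorem finrank_range_le_of_injOn {E : Type*} [NormedAddCommGroup E] [NormedSpace ℝ E]
    [FiniteDimensional ℝ E] {p q : E →L[ℝ] E} (h : ∀ x ∈ q.range, p x = 0 → x = 0) :
    Module.finrank ℝ q.range ≤ Module.finrank ℝ p.range := by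
  let g : q.range →ₗ[ℝ] p.range :=
    (p.toLinearMap.rangeRestrict).comp q.range.subtype
  refine LinearMap.finrank_le_finrank_of_injective (f := g) ?_
  rw [← LinearMap.ker_eq_bot, LinearMap.ker_eq_bot']
  rintro ⟨x, hx⟩ hgx
  have : p x = 0 := congrArg Subtype.val hgx
  exact Subtype.ext (h x hx this)

section

variable {E : Type*} [NormedAddCommGroup E] [NormedSpace ℝ E] [FiniteDimensional ℝ E]
  {J : Set ℝ} {B P : ℝ → E →L[ℝ] E} {Φ Ψ : ℝ → ℝ → E →L[ℝ] E} {K α δ : ℝ}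

open MeasureTheory in
theorem IsDichotomy.norm_greenOp_mul_apply_le (h : IsDichotomy Φ J P K α) (hδ0 : 0 ≤ δ)
    (hB : LocallyBoundedOn B J) (hBδ : ∀ t ∈ J, ‖B t‖ ≤ δ) {F : ℝ → E →L[ℝ] E}
    (hF : LocallyBoundedOn F J) (hFb : ∃ M, ∀ t ∈ J, ‖F t‖ ≤ M) {x : E} {N t : ℝ} (hN0 : 0 ≤ N)
    (hN : ∀ u ∈ J, ‖F u x‖ ≤ N) (ht : t ∈ J) :
    ‖greenOp Φ P J (fun u => B u * F u) t x‖ ≤ K * (2 / α) * δ * N := by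
  have := FiniteDimensional.complete ℝ E
  obtain ⟨M, hM⟩ := exists_bound_mul ⟨δ, hBδ⟩ hFb
  have hi := integral_exp_neg_abs h.pos t
  have hK : 0 ≤ K := zero_le_one.trans h.one_le
  unfold greenOp
  rw [ContinuousLinearMap.integral_apply (h.integrable_green_mul (hB.mul hF) hM ht)]
  refine (norm_integral_le_of_norm_le
    (((hi.1.const_mul K).mul_const (δ * N)).integrableOn (s := J)) ?_).trans ?_
  · filter_upwards [ae_restrict_mem h.closed.measurableSet] with u hu
    have h1 : ‖B u (F u x)‖ ≤ δ * N := (B u).le_of_opNorm_le_of_le (hBδ u hu) (hN u hu)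
    exact (green Φ P t u).le_of_opNorm_le_of_le (h.norm_green_le ht hu) h1
  · rw [integral_mul_const, integral_const_mul, mul_assoc _ δ]
    gcongr
    rw [← hi.2]
    exact setIntegral_le_integral hi.1 (Eventually.of_forall fun u => (Real.exp_pos _).le)

/-- If Qx = x and Px = 0, then F(t)x vanishes for t < s and its free term vanishes for t ≥ s, so its
sup norm contracts to 0. If Px = x and Qx = 0 the two half-lines exchange roles, F(·)x = 0, and the
equation at s gives x = 0. -/
theorem IsDichotomy.finrank_range_perturbedGreen (h : IsDichotomy Φ J P K α)
    (hΨ : IsPerturbation Φ Ψ B J) (hδ0 : 0 ≤ δ) (hBδ : ∀ t ∈ J, ‖B t‖ ≤ δ)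
    (hlt : K * (2 / α) * δ < 1) {F : ℝ → E →L[ℝ] E} {s : ℝ} (hs : s ∈ J)
    (hF : IsPerturbedGreen Φ P B J s F) (hidem : F s * F s = F s) :
    Module.finrank ℝ (F s).range = Module.finrank ℝ (P s).range := by
  have := FiniteDimensional.complete ℝ E
  have hα := h.pos
  have hK : 0 ≤ K := zero_le_one.trans h.one_le
  have hFΨ := fun t ht => h.perturbedGreen_eq hΨ ⟨δ, hBδ⟩ hF hs (t := t) ht
  obtain ⟨M, hM⟩ := hF.bound
  apply le_antisymm
  · refine finrank_range_le_of_injOn ?_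
    rintro _ ⟨y, rfl⟩ hx
    set x := F s y with hxdef
    change P s x = 0 at hx
    change x = 0
    have hFx : F s x = x := congrArg (fun T : E →L[ℝ] E => T y) hidem
    have := nonpos_of_bound_improves (g := fun t => ‖F t x‖) (J := J) (by positivity) hlt
      (M := M * ‖x‖) (fun t ht => (F t).le_of_opNorm_le (hM t ht) x) (fun N hN0 hN t ht => ?_) s hs
    · rw [hFx] at this
      exact norm_le_zero_iff.1 this
    · rcases lt_or_ge t s with hts | hst
      · have : F t x = 0 := by
          rw [hFΨ t ht, if_pos hts]
          simp [hFx]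
        rw [this, norm_zero]
        positivity
      · have h1 : F t x = greenOp Φ P J (fun u => B u * F u) t x := by
          have h2 : green Φ P t s x = 0 := by
            rw [green_eq, if_neg (not_lt.2 hst)]
            simp [hx]
          conv_lhs => rw [hF.eq t ht]
          simp [h2]
        rw [h1]
        exact h.norm_greenOp_mul_apply_le hδ0 hΨ.bdd hBδ hF.bdd ⟨M, hM⟩ hN0 hN ht
  · refine finrank_range_le_of_injOn ?_
    rintro _ ⟨y, rfl⟩ hx
    set x := P s y with hxdef
    change F s x = 0 at hx
    change x = 0
    have hPx : P s x = x := congrArg (fun T : E →L[ℝ] E => T y) (h.idem s hs)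
    have hnp := nonpos_of_bound_improves (g := fun t => ‖F t x‖) (J := J) (by positivity) hlt
      (M := M * ‖x‖) (fun t ht => (F t).le_of_opNorm_le (hM t ht) x) (fun N hN0 hN t ht => ?_)
    · have h1 := h.norm_greenOp_mul_apply_le hδ0 hΨ.bdd hBδ hF.bdd ⟨M, hM⟩ le_rfl hnp hs
      rw [mul_zero] at h1
      have h2 := congrArg (fun T : E →L[ℝ] E => T x) (hF.eq s hs)
      simp only [add_apply, h.green_self hs, hx, hPx,
        norm_le_zero_iff.1 h1, add_zero] at h2
      exact h2.symm
    · rcases lt_or_ge t s with hts | hst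
      · have h1 : F t x = greenOp Φ P J (fun u => B u * F u) t x := by
          have h2 : green Φ P t s x = 0 := by
            rw [green_eq, if_pos hts]
            simp [hPx]
          conv_lhs => rw [hF.eq t ht]
          simp [h2]
        rw [h1]
        exact h.norm_greenOp_mul_apply_le hδ0 hΨ.bdd hBδ hF.bdd ⟨M, hM⟩ hN0 hN ht
      · have : F t x = 0 := by
          rw [hFΨ t ht, if_neg (not_lt.2 hst)]
          simp [hx]
        rw [this, norm_zero]
        positivity

end

/-! ### Constants and the theorem -/

/-- The argument yields the constant K/r; the stated L exceeds it by the factor (1+r²)/(r+r²), at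
least 1 for r ≤ 1. -/
theorem div_sqrt_le_dichotomy_const {K r : ℝ} (hK : 0 ≤ K) (hr : 0 < r) (hr1 : r ≤ 1) :
    K / r ≤ 2 * K * (1 + (1 - r ^ 2) / 2 / r ^ 2) / (1 + r) := by
  have e : 2 * K * (1 + (1 - r ^ 2) / 2 / r ^ 2) / (1 + r) =
      K / r * ((1 + r ^ 2) / (r * (1 + r))) := by
    field_simp
    ring
  rw [e]
  refine le_mul_of_one_le_right (by positivity) ?_
  rw [one_le_div (by positivity)]
  linarith

theorem theorem5p4 {E : Type*} [NormedAddCommGroup E] [NormedSpace ℝ E] [FiniteDimensional ℝ E]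
    (J : Set ℝ) (hJ : (∃ a, J = Ici a) ∨ (∃ b, J = Iic b) ∨ J = univ)
    (A B P : ℝ → E →L[ℝ] E) (K α δ : ℝ)
    (hA : PiecewiseContinuousOn A J) (hB : PiecewiseContinuousOn B J)
    (hdich : HasExpDichotomy A J P K α)
    (hBδ : ∀ t ∈ J, ‖B t‖ ≤ δ) (hδ : 2 * K * δ / α < 1)
    (β L : ℝ) (hβ : β = α * Real.sqrt (1 - 2 * K * δ / α))
    (hL : L = 2 * K * (1 + K * δ / (α * (1 - 2 * K * δ / α))) /
      (1 + Real.sqrt (1 - 2 * K * δ / α))) :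
    ∃ Q : ℝ → E →L[ℝ] E,
      HasExpDichotomy (fun t => A t + B t) J Q L β ∧
      (∀ t ∈ J, Module.finrank ℝ (Q t).range = Module.finrank ℝ (P t).range) ∧
      ∀ t ∈ J, ‖Q t - P t‖ ≤ 2 * K * L * δ / (α + β) := by
  have := FiniteDimensional.complete ℝ E
  obtain ⟨hJc, hJo, s₀, hs₀⟩ : IsClosed J ∧ J.OrdConnected ∧ J.Nonempty := by
    rcases hJ with ⟨a, rfl⟩ | ⟨b, rfl⟩ | rfl
    · exact ⟨isClosed_Ici, ordConnected_Ici, nonempty_Ici⟩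
    · exact ⟨isClosed_Iic, ordConnected_Iic, nonempty_Iic⟩
    · exact ⟨isClosed_univ, ordConnected_univ, univ_nonempty⟩
  obtain ⟨hK1, hα, hidem, hrank, Φ, hΦ, hcomm, hst, hun⟩ := hdich
  have hδ0 : 0 ≤ δ := (norm_nonneg _).trans (hBδ s₀ hs₀)
  have hK : 0 ≤ K := zero_le_one.trans hK1
  set r := Real.sqrt (1 - 2 * K * δ / α) with hrdef
  have hr : 0 < r := Real.sqrt_pos.2 (by linarith)
  have hrsq : r ^ 2 = 1 - 2 * K * δ / α := Real.sq_sqrt (by linarith)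
  have hr2 : α * (1 - r ^ 2) = 2 * K * δ := by
    rw [hrsq]
    field_simp
    ring
  have hr1 : r ≤ 1 := by
    have : 0 ≤ 2 * K * δ / α := by positivity
    rw [hrdef, Real.sqrt_le_one]
    linarith
  have hlt : K * (2 / α) * δ < 1 := by
    have : K * (2 / α) * δ = 2 * K * δ / α := by ring
    rwa [this]
  have hKL : K / r ≤ L := by
    have e : K * δ / (α * (1 - 2 * K * δ / α)) = (1 - r ^ 2) / 2 / r ^ 2 := by
      rw [← hrsq, ← div_div]
      congr 1
      rw [div_eq_div_iff hα.ne' two_ne_zero]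
      linarith
    rw [hL, e]
    exact div_sqrt_le_dichotomy_const hK hr hr1
  have hL0 : 0 ≤ L := (by positivity : 0 ≤ K / r).trans hKL
  have hβpos : 0 < β := by rw [hβ]; positivity
  have hAr : RegularCoeff A J := ⟨hA.locallyBoundedOn hJc, hA.countable_discontinuities⟩
  have hBr : RegularCoeff B J := ⟨hB.locallyBoundedOn hJc, hB.countable_discontinuities⟩
  have hΦe : IsEvolution A J Φ := ⟨hΦ.initial, hΦ.continuousOn, hΦ.deriv_eq⟩
  obtain ⟨Ψ, hΨe⟩ := exists_isEvolution hJc hJo (hAr.bdd.add hBr.bdd)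
  have hΨ := hΦe.isPerturbation hΨe hJc hJo hAr hBr
  have h : IsDichotomy Φ J P K α :=
    { closed := hJc
      ordConnected := hJo
      refl := hΦ.initial
      trans := fun t ht u hu s hs => hΦe.trans hJc hJo hAr ht hu hs
      contLeft := hΦ.continuousOn
      contRight := (hΦe.adjoint_properties hJc hJo hAr).1
      idem := hidem
      comm := hcomm
      pos := hα
      one_le := hK1
      stable := hst
      unstable := hun }
  choose! F hFl hFb hFeq using fun s hs =>
    h.exists_perturbed_green hδ0 hBδ hr hr2 hBr.bdd (s := s) hs
  have hFb' : ∀ s ∈ J, ∀ t ∈ J, ‖F s t‖ ≤ L * Real.exp (-β * |t - s|) := fun s hs t ht => by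
    rw [hβ]
    exact (hFb s hs t ht).trans (mul_le_mul_of_nonneg_right hKL (Real.exp_pos _).le)
  have hF : ∀ s ∈ J, IsPerturbedGreen Φ P B J s (F s) := fun s hs => by
    refine ⟨hFl s hs, ⟨L, fun t ht => (hFb' s hs t ht).trans (mul_le_of_le_one_right hL0 ?_)⟩,
      hFeq s hs⟩
    rw [Real.exp_le_one_iff]
    have := mul_nonneg hβpos.le (abs_nonneg (t - s))
    linarith
  have huniq : ∀ f : ℝ → E →L[ℝ] E, (∃ M, ∀ t ∈ J, ‖f t‖ ≤ M) →
      (∀ t ∈ J, f t = greenOp Φ P J (fun u => B u * f u) t) → ∀ t ∈ J, f t = 0 := by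
    rintro f ⟨M, hM⟩ hf
    exact h.eq_zero_of_greenOp_eq hδ0 hBδ hlt hM hf
  have hBb : ∃ M, ∀ t ∈ J, ‖B t‖ ≤ M := ⟨δ, hBδ⟩
  have hrep := fun s hs t ht => h.perturbedGreen_eq hΨ hBb (hF s hs) hs (t := t) ht
  have hQidem := fun s hs => h.perturbedGreen_idem hΨ hBb huniq (hF s hs) hs
  have hQrank : ∀ t ∈ J, Module.finrank ℝ (F t t).range = Module.finrank ℝ (P t).range :=
    fun t ht => h.finrank_range_perturbedGreen hΨ hδ0 hBδ hlt ht (hF t ht) (hQidem t ht)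
  have hdiag : ∀ s ∈ J, ‖greenOp Φ P J (fun u => B u * F s u) s‖ ≤ K / r - K := fun s hs => by
    simpa using h.norm_greenOp_mul_le hδ0 hBδ hr hr2 hs (hFb s hs)
  have hdiff : ∀ s ∈ J, F s s - P s = greenOp Φ P J (fun u => B u * F s u) s := fun s hs => by
    rw [hFeq s hs s hs, h.green_self hs]
    abel
  have hinv : ∀ s ∈ J, ∀ t ∈ J, s ≤ t → F t t * Ψ t s = Ψ t s * F s s := fun s hs t ht hst =>
    h.perturbedGreen_comm hΨ hBb huniq (hF s hs) (hF t ht) hs ht hst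
  refine ⟨fun t => F t t, ⟨?_, hβpos, hQidem, fun s hs t ht => ?_, Ψ,
    ⟨hΨe.refl, hΨe.continuousOn, hΨe.deriv_eq⟩, fun s hs t ht => ?_, fun s hs t ht hst => ?_,
    fun s hs t ht hst => ?_⟩, hQrank, fun t ht => ?_⟩
  · refine hK1.trans (le_trans ?_ hKL)
    rw [le_div_iff₀ hr]
    exact mul_le_of_le_one_right hK hr1
  · rw [hQrank t ht, hQrank s hs, hrank s hs t ht]
  · rcases le_total s t with hst | hst
    · exact (hinv s hs t ht hst).symm
    · have h1 := congrArg (fun T => Ψ t s * T * Ψ t s) (hinv t ht s hs hst)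
      simp only [mul_assoc, hΨ.trans s hs t ht s hs, hΨ.refl s hs, mul_one] at h1
      rw [h1]
      simp only [← mul_assoc, hΨ.trans t ht s hs t ht, hΨ.refl t ht, one_mul]
  · have := hFb' s hs t ht
    rwa [hrep s hs t ht, if_neg (not_lt.2 hst), sub_zero, abs_of_nonneg (sub_nonneg.2 hst)] at this
  · rcases hst.eq_or_lt with rfl | hlt'
    · have e : Ψ s s * (1 - F s s) = (1 - P s) - greenOp Φ P J (fun u => B u * F s u) s := by
        rw [hΨ.refl s hs, one_mul, ← hdiff s hs]
        abel
      have h1 := hun s hs s hs le_rfl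
      rw [hΦ.initial s hs, one_mul, sub_self, mul_zero, Real.exp_zero, mul_one] at h1
      rw [e, sub_self, mul_zero, Real.exp_zero, mul_one]
      refine (norm_sub_le _ _).trans ?_
      linarith [hdiag s hs]
    · have := hFb' t ht s hs
      rw [hrep t ht s hs, if_pos hlt', abs_of_nonpos (by linarith : s - t ≤ 0), neg_sub,
        ← norm_neg, ← mul_neg, neg_sub] at this
      exact this
  · have e : 2 * K * L * δ / (α + β) = L * (1 - r) := by
      rw [hβ, div_eq_iff (by positivity)]
      linear_combination (-L) * hr2
    rw [e]
    simp only [hdiff t ht]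
    refine (hdiag t ht).trans ?_
    have e2 : K / r - K = K / r * (1 - r) := by
      field_simp
    rw [e2]
    exact mul_le_mul_of_nonneg_right hKL (by linarith)
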